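/- **Setting.** Let $n\ge 3$, let $m_1,\dots,m_n>0$, and let $U(q)=\sum_{i<j}\frac{m_im_j}{|q_i-q_j|}$ be the Newtonian potential on $(\mathbb R^4)^n=\mathbb R^{4n}$, $M=\mathrm{diag}(m_1I_4,\dots,m_nI_4)$. A *central configuration* is a $q=(q_1,\dots,q_n)\in\mathbb R^{4n}$ with $q_i\ne q_j$ for $i\neq j$, $\sum_i m_iq_i=0$, $\langle Mq,q\rangle=1$ and $\nabla U(q)+U(q)Mq=0$. It is *planar* (*collinear*) if all $q_i$ lie in a linear subspace of $\mathbb R^4$ of dimension at most $2$ (at most $1$). Let $H(q)=[D^2U(q)+U(q)M]|_{T_q\mathbb S}$, $T_q\mathbb S=\{v:\sum_i m_iv_i=0,\ \langle Mq,v\rangle=0\}$, be the Hessian at $q$ of the restriction of $U$ to the inertia ellipsoid $\mathbb S=\{x:\sum_i m_ix_i=0,\ \langle Mx,x\rangle=1\}$; $n^-(q)$ is its negative index, $n^0(q)=\dim\ker H(q)$, and $q$ is *Morse–Bott non-degenerate* if $n^0(q)=\dim T_q(\mathrm{SO}(4)\cdot q)$, where $T_q(\mathrm{SO}(4)\cdot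 q)=\{(aq_1,\dots,aq_n): a\in\mathfrak{so}(4)\}$; otherwise it is *Morse–Bott degenerate*. Put $\kappa=\sqrt{U(q)}$ and let $\mathbf i=\mathrm{diag}(i,-i)$, $\mathbf j$, $\mathbf k$ be the left multiplications by the quaternion units on $\mathbb R^4$ (so $i$ is the rotation of $\mathbb R^2$ by $\pi/2$). The relative equilibrium (RE) generated by $q$ is $\gamma(t)=(e^{\kappa t\mathbf i}q_1,\dots,e^{\kappa t\mathbf i}q_n)$. It is *planar* if all the points $\gamma_i(t)$ lie in one plane $\Pi$ through the origin. Let $K$ be the block diagonal action on $\mathbb R^{4n}$ of $\kappa\mathbf i$ if $\gamma$ is non-planar, and of the skew map equal to $\kappa\mathbf i$ on $\Pi$ and to $0$ on $\Pi^\perp$ if $\gamma$ is planar (if $\Pi=\mathbb R^2\times\{0\}$, this is $\mathrm{diag}(\kappa i,0)$). In the rotating frame the linearization at $q$ is $\dot z=-JBz$ on $\mathbb R^{8n}$, with $$B=\begin{pmatrix}-D^2U(q)&K^{T}\\K&M^{-1}\end{pmatrix},\qquad J=\begin{pmatrix}0&-I\\I&0\end{pmatrix}.$$ Let $E_1=\{(v,\dots,v,m_1w,\dots,m_nw):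 v,w\in\mathbb R^4\}$ and $E_2=V\times MV$, where $V=\mathrm{span}\{q,\mathbf iq,\mathbf jq,\mathbf kq\}$ if $\gamma$ is non-planar and $V=\mathbb Rq+T_q(\mathrm{SO}(4)\cdot q)$ if $\gamma$ is planar. Let $E_3$ be the symplectic orthogonal complement of $E_1\oplus E_2$ in $\mathbb R^{8n}$; it is $JB$-invariant. Let $B_3$ be the restriction of (the quadratic form of) $B$ to $E_3$ and $JB_3=(JB)|_{E_3}$. Let $k=6$ if $\gamma$ is planar and $q$ is not collinear, and $k=4$ otherwise. The RE $\gamma$ is *spectrally stable* if all complex eigenvalues of $JB_3$ are purely imaginary, *linearly stable* if moreover $JB_3$ is diagonalizable over $\mathbb C$, and spectrally (linearly) *unstable* if it is not spectrally (linearly) stable. **Theorem.** Let $q$ be a central configuration and $\gamma$ the corresponding RE. 1. If $q$ is non-planar and Morse–Bott non-degenerate, or $q$ is arbitrary, Morse–Bott degenerate and $n^0(q)$ is even, then $JB_3$ has a non-trivial Jordan block for the eigenvalue $0$, and $\gamma$ is linearly unstable. 2. Suppose that $n^-\big(B_3|_{\ker (JB_3)^{8n-8-2k}}\big)$ is even.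 If $n^-(q)+n^0(q)$ is even, then $\gamma$ is spectrally unstable. In particular, still under this assumption on $B_3$, if $q$ is Morse–Bott non-degenerate then: (a) if $q$ is non-planar and $n^-(q)$ is even, then $\gamma$ is spectrally unstable; (b) if $q$ is planar and $n^-(q)$ is odd, then $\gamma$ is spectrally unstable. -/

import Mathlib

noncomputable section

namespace NBody

open scoped InnerProductSpace

/-- Euclidean four-space. -/
abbrev E4 : Type := EuclideanSpace ℝ (Fin 4)

/-- Configurations `q = (q₁, …, qₙ)` of `n` points in `ℝ⁴`, i.e. `ℝ^{4n}` with its Euclidean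
structure. -/
abbrev Config (n : ℕ) : Type := PiLp 2 (fun _ : Fin n => E4)

/-- The phase space `T*ℝ^{4n} = ℝ^{8n}`, points written `(Q, P)`. -/
abbrev Phase (n : ℕ) : Type := Config n × Config n

variable {n : ℕ}

/-- The Newtonian potential `U(q) = ∑_{i<j} mᵢ mⱼ / |qᵢ - qⱼ|`. -/
def potential (m : Fin n → ℝ) (q : Config n) : ℝ :=
  ∑ i, ∑ j ∈ Finset.Ioi i, m i * m j / ‖q i - q j‖

/-- Multiplication of the `i`-th body by the scalar `c i`, the block diagonal matrix
`diag(c₁ I₄, …, cₙ I₄)`. -/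
def scaleBodies (c : Fin n → ℝ) : Config n →ₗ[ℝ] Config n where
  toFun q := WithLp.toLp 2 fun i => c i • q i
  map_add' x y := by ext1 i; simp
  map_smul' a x := by ext1 i; simp [smul_comm a]

/-- The mass matrix `M = diag(m₁ I₄, …, mₙ I₄)`. -/
abbrev massMatrix (m : Fin n → ℝ) : Config n →ₗ[ℝ] Config n := scaleBodies m

/-- The inverse mass matrix. -/
abbrev massMatrixInv (m : Fin n → ℝ) : Config n →ₗ[ℝ] Config n := scaleBodies fun i => (m i)⁻¹

/-- The block diagonal action `diag(A, …, A)` on `ℝ^{4n}` of a linear map `A` of `ℝ⁴`. -/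
def blockDiag (n : ℕ) (A : E4 →ₗ[ℝ] E4) : Config n →ₗ[ℝ] Config n where
  toFun q := WithLp.toLp 2 fun i => A (q i)
  map_add' x y := by ext1 i; simp
  map_smul' a x := by ext1 i; simp

/-- The linear map of `ℝ⁴` given by a `4 × 4` matrix. -/
abbrev act (A : Matrix (Fin 4) (Fin 4) ℝ) : E4 →ₗ[ℝ] E4 := Matrix.toEuclideanLin A

/-- (Normalized) central configurations: collision free, with centre of mass at the origin,
`⟨Mq, q⟩ = 1`, and `∇U(q) + (U(q) / ⟨Mq, q⟩) M q = 0`. -/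
structure IsCentralConfiguration (m : Fin n → ℝ) (q : Config n) : Prop where
  collisionFree : ∀ i j, i ≠ j → q i ≠ q j
  centered : ∑ i, m i • q i = 0
  normalized : ⟪massMatrix m q, q⟫_ℝ = 1
  balance : gradient (potential m) q
    + (potential m q / ⟪massMatrix m q, q⟫_ℝ) • massMatrix m q = 0

/-- The configuration is contained in a plane through the origin (this includes collinear
configurations). -/
def IsPlanar (q : Config n) : Prop := Module.finrank ℝ (Submodule.span ℝ (Set.range q)) ≤ 2

/-- The configuration is contained in a line through the origin. -/
def IsCollinear (q : Config n) : Prop := Module.finrank ℝ (Submodule.span ℝ (Set.range q)) ≤ 1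

/-! ### The Hessian of the restricted potential -/

/-- The Hessian operator `D²U(q)`, the derivative of the gradient of `U`. -/
def hessU (m : Fin n → ℝ) (q : Config n) : Config n →ₗ[ℝ] Config n :=
  (fderiv ℝ (gradient (potential m)) q : Config n →L[ℝ] Config n)

/-- The tangent space at `q` of the inertia ellipsoid
`{x | ∑ mᵢ xᵢ = 0, ⟨Mx, x⟩ = 1}`. -/
def tangentEllipsoid (m : Fin n → ℝ) (q : Config n) : Submodule ℝ (Config n) where
  carrier := {v | ∑ i, m i • v i = 0 ∧ ⟪massMatrix m q, v⟫_ℝ = 0}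
  add_mem' := by
    rintro v w ⟨h1, h2⟩ ⟨h3, h4⟩
    refine ⟨?_, ?_⟩
    · simp [smul_add, Finset.sum_add_distrib, h1, h3]
    · rw [inner_add_right, h2, h4, add_zero]
  zero_mem' := by simp
  smul_mem' := by
    rintro c v ⟨h1, h2⟩
    refine ⟨?_, ?_⟩
    · have : ∀ i, m i • (c • v) i = c • (m i • v i) := fun i => by
        rw [PiLp.smul_apply, smul_comm]
      simp only [this, ← Finset.smul_sum, h1, smul_zero]
    · rw [inner_smul_right, h2, mul_zero]

/-- The quadratic form `v ↦ ⟨A v, v⟩` of a linear operator. -/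
def quadForm (A : Config n →ₗ[ℝ] Config n) : QuadraticForm ℝ (Config n) :=
  LinearMap.BilinMap.toQuadraticMap ((innerₗ (Config n)).comp A)

/-- The Hessian `H(q) = [D²U(q) + U(q) M]|_{T_q S}` at a central configuration `q` of the
restriction of `U` to the inertia ellipsoid `S`. -/
def hessian (m : Fin n → ℝ) (q : Config n) : QuadraticForm ℝ (tangentEllipsoid m q) :=
  (quadForm (hessU m q + potential m q • massMatrix m)).restrict (tangentEllipsoid m q)

/-- The Morse index `n⁻(q)`. -/
def morseIndex (m : Fin n → ℝ) (q : Config n) : ℕ := sigNeg (hessian m q)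

/-- The nullity `n⁰(q)`, the dimension of the kernel of `H(q)`. -/
def nullity (m : Fin n → ℝ) (q : Config n) : ℕ :=
  Module.finrank ℝ (hessian m q).radical

/-- The tangent space at `q` of the orbit `SO(4)·q`, i.e. `{(a q₁, …, a qₙ) | a ∈ so(4)}`. -/
def orbitTangent (q : Config n) : Submodule ℝ (Config n) :=
  Submodule.span ℝ {v | ∃ a ∈ LieAlgebra.Orthogonal.so (Fin 4) ℝ, v = blockDiag n (act a) q}

/-- Morse–Bott non-degeneracy: `n⁰(q) = dim T_q(SO(4)·q)`. -/
def IsMorseBottNondegenerate (m : Fin n → ℝ) (q : Config n) : Prop :=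
  nullity m q = Module.finrank ℝ (orbitTangent q)

/-! ### The relative equilibrium generated by a central configuration -/

/-- The angular speed `√λ`, `λ = U(q) / ⟨Mq, q⟩`. -/
def angularSpeed (m : Fin n → ℝ) (q : Config n) : ℝ :=
  √(potential m q / ⟪massMatrix m q, q⟫_ℝ)

/-- Left multiplication by the quaternion unit `𝐢` on `ℝ⁴`, the matrix `diag(i, -i)`. -/
def quatI : Matrix (Fin 4) (Fin 4) ℝ := !![0, -1, 0, 0; 1, 0, 0, 0; 0, 0, 0, 1; 0, 0, -1, 0]

/-- Left multiplication by the quaternion unit `𝐣`. -/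
def quatJ : Matrix (Fin 4) (Fin 4) ℝ := !![0, 0, 1, 0; 0, 0, 0, 1; -1, 0, 0, 0; 0, -1, 0, 0]

/-- Left multiplication by the quaternion unit `𝐤`. -/
def quatK : Matrix (Fin 4) (Fin 4) ℝ := !![0, 0, 0, -1; 0, 0, 1, 0; 0, -1, 0, 0; 1, 0, 0, 0]

/-- The double rotation `diag(Θ, Θ⁻¹)` of `ℝ⁴`, where `Θ` is the plane rotation of angle `φ`. -/
def doubleRotation (φ : ℝ) : Matrix (Fin 4) (Fin 4) ℝ :=
  !![Real.cos φ, -Real.sin φ, 0, 0;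
     Real.sin φ,  Real.cos φ, 0, 0;
     0, 0,  Real.cos φ, Real.sin φ;
     0, 0, -Real.sin φ, Real.cos φ]

/-- The circular relative equilibrium `t ↦ R_d(t) q` generated by `q`. -/
def relEquilibrium (m : Fin n → ℝ) (q : Config n) (t : ℝ) : Config n :=
  blockDiag n (act (doubleRotation (angularSpeed m q * t))) q

/-- The linear span in `ℝ⁴` of all the positions taken by the bodies along the relative
equilibrium. -/
def motionSpan (m : Fin n → ℝ) (q : Config n) : Submodule ℝ E4 :=
  Submodule.span ℝ {x | ∃ t i, x = relEquilibrium m q t i}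

/-- The relative equilibrium is planar: the motion takes place in a plane. -/
def IsPlanarRE (m : Fin n → ℝ) (q : Config n) : Prop :=
  Module.finrank ℝ (motionSpan m q) ≤ 2

/-- The infinitesimal generator of the rotating frame in `ℝ⁴`. For a non-planar relative
equilibrium it is `k_d = k 𝐢`. For a planar one it is the simple rotation which agrees with `k 𝐢`
on the plane of motion and vanishes on the orthogonal complement of that plane; if the plane of
motion is `ℝ² × {0}`, this is the matrix `k_s = diag(k i, 0)`. -/
def frameGenerator (m : Fin n → ℝ) (q : Config n) : E4 →ₗ[ℝ] E4 :=
  open Classical in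
  if IsPlanarRE m q then
    angularSpeed m q • (act quatI ∘ₗ ((motionSpan m q).starProjection : E4 →ₗ[ℝ] E4))
  else angularSpeed m q • act quatI

/-- The `4n × 4n` block diagonal matrix `K_d` (non-planar case) or `K_s` (planar case). -/
def frameK (m : Fin n → ℝ) (q : Config n) : Config n →ₗ[ℝ] Config n :=
  blockDiag n (frameGenerator m q)

/-- The transpose of `frameK`. -/
def frameKT (m : Fin n → ℝ) (q : Config n) : Config n →ₗ[ℝ] Config n :=
  blockDiag n (LinearMap.adjoint (frameGenerator m q))

/-! ### The linearized Hamiltonian system and its invariant subspaces -/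

/-- The standard complex structure `J (Q, P) = (-P, Q)` of `ℝ^{8n}`. -/
def stdJ (n : ℕ) : Phase n →ₗ[ℝ] Phase n :=
  (-LinearMap.snd ℝ (Config n) (Config n)).prod (LinearMap.fst ℝ (Config n) (Config n))

/-- The Euclidean scalar product of `ℝ^{8n}`. -/
def phaseInner (n : ℕ) : LinearMap.BilinForm ℝ (Phase n) :=
  (innerₗ (Config n)).compl₁₂ (LinearMap.fst ℝ _ _) (LinearMap.fst ℝ _ _)
    + (innerₗ (Config n)).compl₁₂ (LinearMap.snd ℝ _ _) (LinearMap.snd ℝ _ _)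

/-- The standard symplectic form `ω₀(z, z') = ⟨J z, z'⟩`. -/
def sympForm (n : ℕ) : LinearMap.BilinForm ℝ (Phase n) := (phaseInner n).comp (stdJ n) LinearMap.id

/-- The symmetric matrix `B = (-D²U(q), Kᵀ; K, M⁻¹)` of the linearization at `q`, in the rotating
frame; the linearized equations are `ż = -J B z`. -/
def matB (m : Fin n → ℝ) (q : Config n) : Phase n →ₗ[ℝ] Phase n :=
  (-(hessU m q) ∘ₗ LinearMap.fst ℝ _ _ + frameKT m q ∘ₗ LinearMap.snd ℝ _ _).prod
    (frameK m q ∘ₗ LinearMap.fst ℝ _ _ + massMatrixInv m ∘ₗ LinearMap.snd ℝ _ _)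

/-- The configurations `(v, …, v)`. -/
def translations (n : ℕ) : Submodule ℝ (Config n) :=
  Submodule.span ℝ {x | ∃ v : E4, x = WithLp.toLp 2 fun _ => v}

/-- The span of `q` and the directions of the rotational symmetry that are split off:
`q, 𝐢q, 𝐣q, 𝐤q` if the relative equilibrium is non-planar, and `q, K_{lr} q` (`l < r`) if it is
planar, where the matrices `k_{lr}` form the standard basis of `so(4)`. -/
def rotationDirections (m : Fin n → ℝ) (q : Config n) : Submodule ℝ (Config n) :=
  open Classical in
  if IsPlanarRE m q then Submodule.span ℝ {q} ⊔ orbitTangent q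
  else Submodule.span ℝ {q, blockDiag n (act quatI) q, blockDiag n (act quatJ) q,
    blockDiag n (act quatK) q}

/-- `E₁ = {(v, …, v, m₁ w, …, mₙ w)}`. -/
def E₁ (m : Fin n → ℝ) : Submodule ℝ (Phase n) :=
  (translations n).prod ((translations n).map (massMatrix m))

/-- `E₂`, spanned by the `(x, 0)` and `(0, M x)` with `x` in `rotationDirections`. -/
def E₂ (m : Fin n → ℝ) (q : Config n) : Submodule ℝ (Phase n) :=
  (rotationDirections m q).prod ((rotationDirections m q).map (massMatrix m))

/-- `E₃`, the symplectic orthogonal complement of `E₁ ⊕ E₂`. -/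
def E₃ (m : Fin n → ℝ) (q : Config n) : Submodule ℝ (Phase n) :=
  (sympForm n).orthogonal (E₁ m ⊔ E₂ m q)

/-! ### Invariance of `E₃` under the linearized dynamics -/

/-- The difference `xᵢ - xⱼ` as a continuous linear map. -/
def diffCLM (i j : Fin n) : Config n →L[ℝ] E4 :=
  PiLp.proj (𝕜 := ℝ) 2 (fun _ : Fin n => E4) i - PiLp.proj (𝕜 := ℝ) 2 (fun _ : Fin n => E4) j

lemma diffCLM_apply (i j : Fin n) (x : Config n) : diffCLM i j x = x i - x j := rfl

lemma sub_ne_zero_of_mem_Ioi {x : Config n} (hx : ∀ i j, i ≠ j → x i ≠ x j) {i j : Fin n}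
    (hj : j ∈ Finset.Ioi i) : x i - x j ≠ 0 :=
  sub_ne_zero.mpr (hx i j (ne_of_lt (Finset.mem_Ioi.mp hj)))

lemma contDiffAt_potential (m : Fin n → ℝ) {x : Config n} (hx : ∀ i j, i ≠ j → x i ≠ x j) :
    ContDiffAt ℝ 2 (potential m) x := by
  unfold potential
  refine ContDiffAt.sum fun i _ => ContDiffAt.sum fun j hj => ?_
  have h0 := sub_ne_zero_of_mem_Ioi hx hj
  have h1 : ContDiffAt ℝ 2 (fun y : Config n => y i - y j) x := (diffCLM i j).contDiff.contDiffAt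
  exact contDiffAt_const.div (h1.norm ℝ h0) (norm_ne_zero_iff.mpr h0)

lemma hasDerivAt_div_norm (c : ℝ) {a : E4} (ha : a ≠ 0) (b : E4) :
    HasDerivAt (fun t : ℝ => c / ‖a + t • b‖) (-(c * ⟪a, b⟫_ℝ / ‖a‖ ^ 3)) 0 := by
  have hn : ‖a‖ ≠ 0 := norm_ne_zero_iff.mpr ha
  have h2 : HasDerivAt (fun t : ℝ => a + t • b) b 0 := by
    simpa using ((hasDerivAt_id (0 : ℝ)).smul_const b).const_add a
  have h3 : HasDerivAt (fun t : ℝ => ‖a + t • b‖) (⟪a, b⟫_ℝ / ‖a‖) 0 := by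
    have h4 := (h2.norm_sq).sqrt (by simpa using ha)
    simp only [Real.sqrt_sq (norm_nonneg _)] at h4
    convert h4 using 1
    simp
    field_simp
  have h5 := (h3.inv (by simpa using ha)).const_mul c
  have h6 : -(c * ⟪a, b⟫_ℝ / ‖a‖ ^ 3) = c * (-(⟪a, b⟫_ℝ / ‖a‖) / ‖a + (0 : ℝ) • b‖ ^ 2) := by
    rw [zero_smul, add_zero]
    field_simp
  rw [h6]
  simp only [div_eq_mul_inv c]
  exact h5

lemma fderiv_potential (m : Fin n → ℝ) {x : Config n} (hx : ∀ i j, i ≠ j → x i ≠ x j)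
    (v : Config n) : fderiv ℝ (potential m) x v =
      ∑ i, ∑ j ∈ Finset.Ioi i, -(m i * m j * ⟪x i - x j, v i - v j⟫_ℝ / ‖x i - x j‖ ^ 3) := by
  have hd : DifferentiableAt ℝ (potential m) x :=
    (contDiffAt_potential m hx).differentiableAt (by norm_num)
  have h1 := hd.hasFDerivAt.hasLineDerivAt v
  have h2 : HasDerivAt (fun t : ℝ => potential m (x + t • v))
      (∑ i, ∑ j ∈ Finset.Ioi i, -(m i * m j * ⟪x i - x j, v i - v j⟫_ℝ / ‖x i - x j‖ ^ 3)) 0 := by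
    unfold potential
    refine HasDerivAt.fun_sum fun i _ => HasDerivAt.fun_sum fun j hj => ?_
    have h := hasDerivAt_div_norm (m i * m j) (sub_ne_zero_of_mem_Ioi hx hj) (v i - v j)
    have h3 : ∀ t : ℝ, (x + t • v) i - (x + t • v) j = x i - x j + t • (v i - v j) := by
      intro t
      simp only [PiLp.add_apply, PiLp.smul_apply, smul_sub]
      abel
    simpa only [h3] using h
  exact HasDerivAt.unique h1 h2

lemma isOpen_collisionFree : IsOpen {x : Config n | ∀ i j, i ≠ j → x i ≠ x j} := by
  simp only [Set.ofPred_forall]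
  refine isOpen_iInter_of_finite fun i => isOpen_iInter_of_finite fun j =>
    isOpen_iInter_of_finite fun _ => ?_
  exact isOpen_ne_fun (by fun_prop) (by fun_prop)

section Generic

variable {F : Type*} [NormedAddCommGroup F] [InnerProductSpace ℝ F] [CompleteSpace F]

lemma differentiableAt_gradient {f : F → ℝ} {x : F} (hf : ContDiffAt ℝ 2 f x) :
    DifferentiableAt ℝ (gradient f) x := by
  have h1 := (hf.fderiv_right (m := 1) (by norm_num)).differentiableAt (by norm_num)
  exact ((InnerProductSpace.toDual ℝ F).symm.toContinuousLinearEquiv.differentiableAt).comp x h1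

lemma inner_fderiv_gradient {f : F → ℝ} {x : F} (hf : ContDiffAt ℝ 2 f x) (v w : F) :
    ⟪fderiv ℝ (gradient f) x v, w⟫_ℝ = fderiv ℝ (fderiv ℝ f) x v w := by
  have h := (hf.fderiv_right (m := 1) (by norm_num)).differentiableAt (by norm_num)
  have h1 := (differentiableAt_gradient hf).hasFDerivAt.inner ℝ (hasFDerivAt_const w x)
  have h2 := h.hasFDerivAt.clm_apply (hasFDerivAt_const w x)
  simp only [inner_gradient_left] at h1
  have := congrArg (fun A => A v) (h1.unique h2)
  simpa using this

lemma fderiv_gradient_symm {f : F → ℝ} {x : F} (hf : ContDiffAt ℝ 2 f x) (v w : F) :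
    ⟪fderiv ℝ (gradient f) x v, w⟫_ℝ = ⟪v, fderiv ℝ (gradient f) x w⟫_ℝ := by
  rw [inner_fderiv_gradient hf, real_inner_comm, inner_fderiv_gradient hf]
  exact (hf.isSymmSndFDerivAt (by simp)) v w

/-- Differentiating an infinitesimal symmetry `df(x)(A x + e) = c f(x)`. -/
lemma fderiv_gradient_of_symmetry {f : F → ℝ} {x : F} (hf : ContDiffAt ℝ 2 f x)
    (A : F →L[ℝ] F) (e : F) (c : ℝ)
    (h : ∀ᶠ y in nhds x, fderiv ℝ f y (A y + e) = c * f y) (v : F) :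
    ⟪fderiv ℝ (gradient f) x (A x + e), v⟫_ℝ =
      c * ⟪gradient f x, v⟫_ℝ - ⟪gradient f x, A v⟫_ℝ := by
  have hA : HasFDerivAt (fun y : F => A y + e) A x := A.hasFDerivAt.add_const e
  have h1 := (differentiableAt_gradient hf).hasFDerivAt.inner ℝ hA
  have h2 := ((hf.differentiableAt (by norm_num)).hasFDerivAt).const_mul c
  have h3 : (fun y : F => ⟪gradient f y, A y + e⟫_ℝ) =ᶠ[nhds x] fun y => c * f y := by
    filter_upwards [h] with y hy
    rw [inner_gradient_left, hy]
  have h4 := congrArg (fun L => L v) ((h1.congr_of_eventuallyEq h3.symm).unique h2)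
  rw [fderiv_gradient_symm hf, real_inner_comm]
  have h5 : ⟪gradient f x, A v⟫_ℝ + ⟪fderiv ℝ (gradient f) x v, A x + e⟫_ℝ
      = c * fderiv ℝ f x v := h4
  rw [← inner_gradient_left] at h5
  linarith

lemma fderiv_gradient_of_symmetry' [FiniteDimensional ℝ F] {f : F → ℝ} {x : F}
    (hf : ContDiffAt ℝ 2 f x) (A : F →ₗ[ℝ] F) (e : F) (c : ℝ)
    (h : ∀ᶠ y in nhds x, fderiv ℝ f y (A y + e) = c * f y) (v : F) :
    ⟪fderiv ℝ (gradient f) x (A x + e), v⟫_ℝ =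
      c * ⟪gradient f x, v⟫_ℝ - ⟪gradient f x, A v⟫_ℝ :=
  fderiv_gradient_of_symmetry hf (LinearMap.toContinuousLinearMap A) e c h v

end Generic

lemma hessU_symm (m : Fin n → ℝ) {x : Config n} (hx : ∀ i j, i ≠ j → x i ≠ x j)
    (v w : Config n) : ⟪hessU m x v, w⟫_ℝ = ⟪v, hessU m x w⟫_ℝ :=
  fderiv_gradient_symm (contDiffAt_potential m hx) v w

lemma hessU_of_symmetry (m : Fin n → ℝ) {q : Config n} (hq : ∀ i j, i ≠ j → q i ≠ q j)
    (A : Config n →ₗ[ℝ] Config n) (e : Config n) (c : ℝ)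
    (h : ∀ x : Config n, (∀ i j, i ≠ j → x i ≠ x j) →
      fderiv ℝ (potential m) x (A x + e) = c * potential m x) (v : Config n) :
    ⟪hessU m q (A q + e), v⟫_ℝ =
      c * ⟪gradient (potential m) q, v⟫_ℝ - ⟪gradient (potential m) q, A v⟫_ℝ := by
  have h1 : ∀ᶠ y in nhds q, (∀ i j, i ≠ j → y i ≠ y j) :=
    isOpen_collisionFree.mem_nhds hq
  exact fderiv_gradient_of_symmetry' (contDiffAt_potential m hq) A e c
    (h1.mono fun y hy => h y hy) v

lemma inner_config (x y : Config n) : ⟪x, y⟫_ℝ = ∑ i, ⟪x i, y i⟫_ℝ := PiLp.inner_apply x y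

lemma inner_massMatrix (m : Fin n → ℝ) (x y : Config n) :
    ⟪massMatrix m x, y⟫_ℝ = ⟪x, massMatrix m y⟫_ℝ := by
  simp [inner_config, scaleBodies, inner_smul_left, inner_smul_right]

lemma massMatrix_blockDiag (m : Fin n → ℝ) (A : E4 →ₗ[ℝ] E4) (x : Config n) :
    massMatrix m (blockDiag n A x) = blockDiag n A (massMatrix m x) := by
  ext1 i; simp [scaleBodies, blockDiag]

lemma IsCentralConfiguration.gradient_eq {m : Fin n → ℝ} {q : Config n}
    (hq : IsCentralConfiguration m q) :
    gradient (potential m) q = -potential m q • massMatrix m q := by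
  have := hq.balance
  rw [hq.normalized, div_one] at this
  rw [eq_neg_of_add_eq_zero_left this, neg_smul]

lemma hessU_translation {m : Fin n → ℝ} {q : Config n} (hq : IsCentralConfiguration m q)
    (v : E4) : hessU m q (WithLp.toLp 2 fun _ => v) = 0 := by
  refine ext_inner_right ℝ fun w => ?_
  have := hessU_of_symmetry m hq.collisionFree 0 (WithLp.toLp 2 fun _ => v) 0
    (fun x hx => by rw [fderiv_potential m hx]; simp) w
  simpa using this

lemma hessU_self {m : Fin n → ℝ} {q : Config n} (hq : IsCentralConfiguration m q) :
    hessU m q q = (2 * potential m q) • massMatrix m q := by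
  refine ext_inner_right ℝ fun w => ?_
  have := hessU_of_symmetry m hq.collisionFree LinearMap.id 0 (-1) (fun x hx => by
    rw [fderiv_potential m hx, potential, Finset.mul_sum]
    refine Finset.sum_congr rfl fun i _ => ?_
    rw [Finset.mul_sum]
    refine Finset.sum_congr rfl fun j hj => ?_
    have hn : ‖x i - x j‖ ≠ 0 := norm_ne_zero_iff.mpr (sub_ne_zero_of_mem_Ioi hx hj)
    simp
    field_simp) w
  simp only [LinearMap.id_apply, add_zero] at this
  rw [this, hq.gradient_eq]
  simp only [inner_smul_left]
  simp
  ring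

/-- A linear map of `ℝ⁴` is skew if `⟨a x, y⟩ = -⟨x, a y⟩`. -/
def IsSkew (a : E4 →ₗ[ℝ] E4) : Prop := ∀ x y, ⟪a x, y⟫_ℝ = -⟪x, a y⟫_ℝ

lemma IsSkew.inner_self {a : E4 →ₗ[ℝ] E4} (ha : IsSkew a) (x : E4) : ⟪x, a x⟫_ℝ = 0 := by
  have := ha x x
  rw [real_inner_comm] at this
  linarith

lemma hessU_skew {m : Fin n → ℝ} {q : Config n} (hq : IsCentralConfiguration m q)
    {a : E4 →ₗ[ℝ] E4} (ha : IsSkew a) :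
    hessU m q (blockDiag n a q) = (-potential m q) • massMatrix m (blockDiag n a q) := by
  refine ext_inner_right ℝ fun w => ?_
  have := hessU_of_symmetry m hq.collisionFree (blockDiag n a) 0 0 (fun x hx => by
    rw [fderiv_potential m hx]
    simp [blockDiag, ← map_sub, ha.inner_self]) w
  simp only [add_zero] at this
  rw [this, hq.gradient_eq, massMatrix_blockDiag]
  simp only [inner_smul_left, inner_config]
  simp [blockDiag, ha _ _]

lemma isSkew_act {a : Matrix (Fin 4) (Fin 4) ℝ} (ha : a.transpose = -a) : IsSkew (act a) := by
  intro x y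
  have h : ∀ i j, a j i = -a i j := fun i j => congrFun (congrFun ha i) j
  simp only [PiLp.inner_apply, act, Matrix.toLpLin_apply, Matrix.mulVec, dotProduct,
    RCLike.inner_apply, conj_trivial, Finset.mul_sum, Finset.sum_mul]
  rw [Finset.sum_comm, ← Finset.sum_neg_distrib]
  refine Finset.sum_congr rfl fun i _ => ?_
  rw [← Finset.sum_neg_distrib]
  refine Finset.sum_congr rfl fun j _ => ?_
  rw [h i j]; ring

lemma quatI_skew : IsSkew (act quatI) :=
  isSkew_act (by ext i j; fin_cases i <;> fin_cases j <;> simp [quatI])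
lemma quatJ_skew : IsSkew (act quatJ) :=
  isSkew_act (by ext i j; fin_cases i <;> fin_cases j <;> simp [quatJ])
lemma quatK_skew : IsSkew (act quatK) :=
  isSkew_act (by ext i j; fin_cases i <;> fin_cases j <;> simp [quatK])

lemma act_mul (A B : Matrix (Fin 4) (Fin 4) ℝ) (x : E4) : act (A * B) x = act A (act B x) := by
  simp [act, Matrix.toLpLin_apply]

lemma act_quatI_quatI (x : E4) : act quatI (act quatI x) = -x := by
  rw [← act_mul]
  have : quatI * quatI = -1 := by
    ext i j; fin_cases i <;> fin_cases j <;> simp [quatI, Matrix.mul_apply, Fin.sum_univ_four]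
  rw [this]; simp [act]

lemma quatI_mul_quatJ : quatI * quatJ = quatK := by
  ext i j; fin_cases i <;> fin_cases j <;>
    simp [quatI, quatJ, quatK, Matrix.mul_apply, Fin.sum_univ_four]

lemma quatI_mul_quatK : quatI * quatK = -quatJ := by
  ext i j; fin_cases i <;> fin_cases j <;>
    simp [quatI, quatJ, quatK, Matrix.mul_apply, Fin.sum_univ_four]

lemma quatI_mul_doubleRotation (φ : ℝ) :
    quatI * doubleRotation φ = doubleRotation (φ + Real.pi / 2) := by
  ext i j; fin_cases i <;> fin_cases j <;>
    simp [quatI, doubleRotation, Matrix.mul_apply, Fin.sum_univ_four, Real.cos_add_pi_div_two,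
      Real.sin_add_pi_div_two]

lemma mem_motionSpan (m : Fin n → ℝ) (q : Config n) (i : Fin n) : q i ∈ motionSpan m q := by
  refine Submodule.subset_span ⟨0, i, ?_⟩
  have : doubleRotation (angularSpeed m q * 0) = 1 := by
    ext i j; fin_cases i <;> fin_cases j <;> simp [doubleRotation]
  simp only [relEquilibrium, this, blockDiag]
  simp [act]

lemma quatI_mem_motionSpan (m : Fin n → ℝ) (q : Config n) (hk : angularSpeed m q ≠ 0) {x : E4}
    (hx : x ∈ motionSpan m q) : act quatI x ∈ motionSpan m q := by
  unfold motionSpan at hx ⊢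
  induction hx using Submodule.span_induction with
  | mem x h =>
    obtain ⟨t, i, rfl⟩ := h
    refine Submodule.subset_span ⟨t + Real.pi / 2 / angularSpeed m q, i, ?_⟩
    have h1 : angularSpeed m q * (t + Real.pi / 2 / angularSpeed m q)
        = angularSpeed m q * t + Real.pi / 2 := by field_simp
    simp only [relEquilibrium, h1, ← quatI_mul_doubleRotation, blockDiag]
    exact (act_mul _ _ _).symm
  | zero => simp
  | add x y _ _ h1 h2 => rw [map_add]; exact add_mem h1 h2
  | smul c x _ h => rw [map_smul]; exact Submodule.smul_mem _ c h

lemma starProjection_comm {a : E4 →ₗ[ℝ] E4} (ha : IsSkew a) {W : Submodule ℝ E4}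
    (hW : ∀ x ∈ W, a x ∈ W) (x : E4) : W.starProjection (a x) = a (W.starProjection x) := by
  refine Submodule.eq_starProjection_of_mem_of_inner_eq_zero
    (hW _ (W.starProjection_apply_mem x)) fun w hw => ?_
  rw [← map_sub, ha, W.starProjection_inner_eq_zero x _ (hW w hw), neg_zero]

lemma frameGenerator_skew (m : Fin n → ℝ) (q : Config n) : IsSkew (frameGenerator m q) := by
  unfold frameGenerator
  split_ifs with h
  · by_cases hk : angularSpeed m q = 0
    · intro x y; simp [hk]
    · intro x y
      have h1 := starProjection_comm quatI_skew (fun x hx => quatI_mem_motionSpan m q hk hx) y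
      simp only [LinearMap.smul_apply, LinearMap.comp_apply, ContinuousLinearMap.coe_coe,
        inner_smul_left, inner_smul_right, conj_trivial]
      rw [quatI_skew, Submodule.inner_starProjection_left_eq_right, h1, mul_neg]
  · intro x y
    simp only [LinearMap.smul_apply, inner_smul_left, inner_smul_right, conj_trivial]
    rw [quatI_skew, mul_neg]

lemma frameKT_eq (m : Fin n → ℝ) (q : Config n) : frameKT m q = -frameK m q := by
  have h : LinearMap.adjoint (frameGenerator m q) = -frameGenerator m q := by
    symm
    rw [LinearMap.eq_adjoint_iff]
    intro x y
    rw [LinearMap.neg_apply, inner_neg_left, frameGenerator_skew, neg_neg]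
  unfold frameKT frameK
  rw [h]
  ext x i : 2
  simp [blockDiag]

lemma inner_frameK (m : Fin n → ℝ) (q x y : Config n) :
    ⟪frameK m q x, y⟫_ℝ = -⟪x, frameK m q y⟫_ℝ := by
  simp [inner_config, frameK, blockDiag, frameGenerator_skew m q _ _]

lemma translations_eq {x : Config n} (hx : x ∈ translations n) :
    ∃ v : E4, x = WithLp.toLp 2 fun _ => v := by
  unfold translations at hx
  induction hx using Submodule.span_induction with
  | mem x h => exact h
  | zero => exact ⟨0, by ext1 i; simp⟩
  | add x y _ _ h1 h2 =>
    obtain ⟨v, rfl⟩ := h1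
    obtain ⟨w, rfl⟩ := h2
    exact ⟨v + w, by ext1 i; simp⟩
  | smul c x _ h =>
    obtain ⟨v, rfl⟩ := h
    exact ⟨c • v, by ext1 i; simp⟩

lemma frameK_translations (m : Fin n → ℝ) (q : Config n) {x : Config n}
    (hx : x ∈ translations n) : frameK m q x ∈ translations n := by
  obtain ⟨v, rfl⟩ := translations_eq hx
  exact Submodule.subset_span ⟨frameGenerator m q v, rfl⟩

lemma orbitTangent_eq {q x : Config n} (hx : x ∈ orbitTangent q) :
    ∃ a : E4 →ₗ[ℝ] E4, IsSkew a ∧ x = blockDiag n a q := by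
  unfold orbitTangent at hx
  induction hx using Submodule.span_induction with
  | mem x h =>
    obtain ⟨a, ha, rfl⟩ := h
    exact ⟨act a, isSkew_act ((LieAlgebra.Orthogonal.mem_so _ _ a).mp ha), rfl⟩
  | zero => exact ⟨0, fun x y => by simp, by ext1 i; simp [blockDiag]⟩
  | add x y _ _ h1 h2 =>
    obtain ⟨a, ha, rfl⟩ := h1
    obtain ⟨b, hb, rfl⟩ := h2
    refine ⟨a + b, fun x y => ?_, by ext1 i; simp [blockDiag]⟩
    simp only [LinearMap.add_apply, inner_add_left, inner_add_right, ha x y, hb x y]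
    ring
  | smul c x _ h =>
    obtain ⟨a, ha, rfl⟩ := h
    refine ⟨c • a, fun x y => ?_, by ext1 i; simp [blockDiag]⟩
    simp only [LinearMap.smul_apply, inner_smul_left, inner_smul_right, ha x y, conj_trivial]
    ring

lemma quatI_mem_so : quatI ∈ LieAlgebra.Orthogonal.so (Fin 4) ℝ := by
  rw [LieAlgebra.Orthogonal.mem_so]
  ext i j; fin_cases i <;> fin_cases j <;> simp [quatI]

/-- On an `𝐢`-invariant plane, the compression of a skew map is a multiple of `𝐢`. -/
lemma starProjection_skew {a : E4 →ₗ[ℝ] E4} (ha : IsSkew a) {W : Submodule ℝ E4}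
    (hW : ∀ x ∈ W, act quatI x ∈ W) (hd : Module.finrank ℝ W ≤ 2) :
    ∃ c : ℝ, ∀ x ∈ W, W.starProjection (a x) = c • act quatI x := by
  by_cases h0 : W = ⊥
  · refine ⟨0, fun x hx => ?_⟩
    rw [h0, Submodule.mem_bot] at hx
    simp [hx]
  obtain ⟨u, hu, hu0⟩ := Submodule.exists_mem_ne_zero_of_ne_bot h0
  set I : E4 →ₗ[ℝ] E4 := act quatI with hI
  have hIu : ⟪I u, u⟫_ℝ = 0 := by rw [real_inner_comm]; exact quatI_skew.inner_self u
  have huu : ⟪u, u⟫_ℝ ≠ 0 := inner_self_ne_zero.mpr hu0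
  have hII : ⟪I u, I u⟫_ℝ = ⟪u, u⟫_ℝ := by
    rw [hI, quatI_skew, act_quatI_quatI, inner_neg_right, neg_neg]
  have hli : LinearIndependent ℝ ![u, I u] := by
    rw [LinearIndependent.pair_iff]
    intro s t hst
    have h1 : ⟪s • u + t • I u, u⟫_ℝ = 0 := by rw [hst, inner_zero_left]
    have h2 : ⟪s • u + t • I u, I u⟫_ℝ = 0 := by rw [hst, inner_zero_left]
    rw [inner_add_left, inner_smul_left, inner_smul_left, hIu] at h1
    rw [inner_add_left, inner_smul_left, inner_smul_left, real_inner_comm, hIu, hII] at h2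
    simp only [conj_trivial, mul_zero, add_zero, zero_add, mul_eq_zero, huu, or_false] at h1 h2
    exact ⟨h1, h2⟩
  have hspan : Submodule.span ℝ {u, I u} = W := by
    refine Submodule.eq_of_le_of_finrank_le ?_ ?_
    · rw [Submodule.span_le]
      rintro x (rfl | rfl)
      · exact hu
      · exact hW _ hu
    · have := finrank_span_eq_card hli
      have h2 : Set.range ![u, I u] = {u, I u} := by simp [Matrix.range_cons, Set.pair_comm]
      rw [h2] at this
      rw [this]; exact hd
  have hrep : ∀ x ∈ W, ∃ α β : ℝ, x = α • u + β • I u := by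
    intro x hx
    rw [← hspan, Submodule.mem_span_pair] at hx
    obtain ⟨α, β, h⟩ := hx
    exact ⟨α, β, h.symm⟩
  refine ⟨⟪a u, I u⟫_ℝ / ⟪u, u⟫_ℝ, fun x hx => ?_⟩
  refine Submodule.eq_starProjection_of_mem_of_inner_eq_zero
    (W.smul_mem _ (hW x hx)) fun w hw => ?_
  obtain ⟨α, β, rfl⟩ := hrep x hx
  obtain ⟨γ, δ, rfl⟩ := hrep w hw
  have e1 : ⟪a u, u⟫_ℝ = 0 := by rw [real_inner_comm]; exact ha.inner_self u
  have e2 : ⟪a (I u), I u⟫_ℝ = 0 := by rw [real_inner_comm]; exact ha.inner_self (I u)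
  have e3 : ⟪a (I u), u⟫_ℝ = -⟪a u, I u⟫_ℝ := by rw [ha, real_inner_comm]
  have e4 : I (I u) = -u := act_quatI_quatI u
  have e5 : ⟪u, I u⟫_ℝ = 0 := by rw [real_inner_comm]; exact hIu
  simp only [map_add, map_smul, e4, inner_sub_left, inner_add_left, inner_add_right,
    inner_smul_left, inner_smul_right, inner_neg_left, conj_trivial, e1, e2, e3, hIu, hII, e5]
  field_simp
  ring

lemma frameK_rotationDirections (m : Fin n → ℝ) (q : Config n) {x : Config n}
    (hx : x ∈ rotationDirections m q) : frameK m q x ∈ rotationDirections m q := by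
  by_cases hk : angularSpeed m q = 0
  · have : frameK m q x = 0 := by
      unfold frameK frameGenerator
      ext1 i
      simp [blockDiag, hk]
    rw [this]; exact zero_mem _
  by_cases hp : IsPlanarRE m q
  · have hR : rotationDirections m q = Submodule.span ℝ {q} ⊔ orbitTangent q := by
      unfold rotationDirections; rw [if_pos hp]
    have hG : frameGenerator m q = angularSpeed m q •
        (act quatI ∘ₗ ((motionSpan m q).starProjection : E4 →ₗ[ℝ] E4)) := by
      unfold frameGenerator; rw [if_pos hp]
    rw [hR] at hx ⊢
    have hI : ∀ x ∈ motionSpan m q, act quatI x ∈ motionSpan m q :=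
      fun x hx => quatI_mem_motionSpan m q hk hx
    obtain ⟨y, hy, z, hz, rfl⟩ := Submodule.mem_sup.mp hx
    rw [map_add]
    refine add_mem ?_ ?_
    · obtain ⟨c, rfl⟩ := Submodule.mem_span_singleton.mp hy
      rw [map_smul]
      refine Submodule.smul_mem _ _ (Submodule.mem_sup_right ?_)
      have : frameK m q q = angularSpeed m q • blockDiag n (act quatI) q := by
        ext1 i
        simp only [frameK, hG, blockDiag]
        simp [(Submodule.starProjection_eq_self_iff).mpr (mem_motionSpan m q i)]
      rw [this]
      exact Submodule.smul_mem _ _ (Submodule.subset_span ⟨quatI, quatI_mem_so, rfl⟩)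
    · obtain ⟨a, ha, rfl⟩ := orbitTangent_eq hz
      obtain ⟨c, hc⟩ := starProjection_skew ha hI hp
      refine Submodule.mem_sup_left (Submodule.mem_span_singleton.mpr ⟨-(angularSpeed m q * c), ?_⟩)
      ext1 i
      simp only [frameK, hG, blockDiag]
      simp [hc _ (mem_motionSpan m q i), act_quatI_quatI, mul_smul]
  · have hR : rotationDirections m q = Submodule.span ℝ {q, blockDiag n (act quatI) q,
        blockDiag n (act quatJ) q, blockDiag n (act quatK) q} := by
      unfold rotationDirections; rw [if_neg hp]
    have hG : frameGenerator m q = angularSpeed m q • act quatI := by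
      unfold frameGenerator; rw [if_neg hp]
    have hF : ∀ y, frameK m q y = angularSpeed m q • blockDiag n (act quatI) y := by
      intro y; ext1 i; simp [frameK, hG, blockDiag]
    rw [hR] at hx ⊢
    induction hx using Submodule.span_induction with
    | zero => simp
    | add x y _ _ h1 h2 => rw [map_add]; exact add_mem h1 h2
    | smul c x _ h => rw [map_smul]; exact Submodule.smul_mem _ c h
    | mem x h =>
      rw [hF]
      refine Submodule.smul_mem _ _ ?_
      rcases h with rfl | rfl | rfl | rfl
      · exact Submodule.subset_span (by simp)
      · have : blockDiag n (act quatI) (blockDiag n (act quatI) q) = -q := by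
          ext1 i; simp [blockDiag, act_quatI_quatI]
        rw [this]
        exact neg_mem (Submodule.subset_span (by simp))
      · have : blockDiag n (act quatI) (blockDiag n (act quatJ) q)
            = blockDiag n (act quatK) q := by
          ext1 i; simp only [blockDiag, ← quatI_mul_quatJ]; exact (act_mul _ _ _).symm
        rw [this]
        exact Submodule.subset_span (by simp)
      · have : blockDiag n (act quatI) (blockDiag n (act quatK) q)
            = -blockDiag n (act quatJ) q := by
          ext1 i
          have := act_mul quatI quatK (q i)
          rw [quatI_mul_quatK] at this
          simp only [blockDiag]
          exact this.symm.trans (by simp [act])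
        rw [this]
        exact neg_mem (Submodule.subset_span (by simp))

lemma hessU_rotationDirections {m : Fin n → ℝ} {q : Config n} (hq : IsCentralConfiguration m q)
    {x : Config n} (hx : x ∈ rotationDirections m q) :
    hessU m q x ∈ (rotationDirections m q).map (massMatrix m) := by
  have key : ∀ (R : Submodule ℝ (Config n)), (∃ c : ℝ, ∃ y ∈ R, hessU m q x = c • massMatrix m y) →
      hessU m q x ∈ R.map (massMatrix m) := by
    rintro R ⟨c, y, hy, h⟩
    rw [h]
    exact Submodule.smul_mem _ _ (Submodule.mem_map_of_mem hy)
  by_cases hp : IsPlanarRE m q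
  · have hR : rotationDirections m q = Submodule.span ℝ {q} ⊔ orbitTangent q := by
      unfold rotationDirections; rw [if_pos hp]
    rw [hR] at hx ⊢
    obtain ⟨y, hy, z, hz, rfl⟩ := Submodule.mem_sup.mp hx
    rw [map_add]
    refine add_mem ?_ ?_
    · obtain ⟨c, rfl⟩ := Submodule.mem_span_singleton.mp hy
      rw [map_smul, hessU_self hq]
      exact Submodule.smul_mem _ _ (Submodule.smul_mem _ _ (Submodule.mem_map_of_mem
        (Submodule.mem_sup_left (Submodule.mem_span_singleton_self q))))
    · obtain ⟨a, ha, h⟩ := orbitTangent_eq hz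
      have h2 : hessU m q z = (-potential m q) • massMatrix m z := by rw [h, hessU_skew hq ha]
      rw [h2]
      exact Submodule.smul_mem _ _ (Submodule.mem_map_of_mem (Submodule.mem_sup_right hz))
  · have hR : rotationDirections m q = Submodule.span ℝ {q, blockDiag n (act quatI) q,
        blockDiag n (act quatJ) q, blockDiag n (act quatK) q} := by
      unfold rotationDirections; rw [if_neg hp]
    rw [hR] at hx ⊢
    clear key
    induction hx using Submodule.span_induction with
    | zero => simp
    | add x y _ _ h1 h2 => rw [map_add]; exact add_mem h1 h2
    | smul c x _ h => rw [map_smul]; exact Submodule.smul_mem _ c h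
    | mem x h =>
      have hx := Submodule.mem_map_of_mem (f := massMatrix m) (Submodule.subset_span h)
      rcases h with rfl | rfl | rfl | rfl
      · rw [hessU_self hq]; exact Submodule.smul_mem _ _ hx
      · rw [hessU_skew hq quatI_skew]; exact Submodule.smul_mem _ _ hx
      · rw [hessU_skew hq quatJ_skew]; exact Submodule.smul_mem _ _ hx
      · rw [hessU_skew hq quatK_skew]; exact Submodule.smul_mem _ _ hx

/-- The matrix `J B`. -/
def matJB (m : Fin n → ℝ) (q : Config n) : Phase n →ₗ[ℝ] Phase n := stdJ n ∘ₗ matB m q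

lemma matB_apply (m : Fin n → ℝ) (q x p : Config n) : matB m q (x, p) =
    (-hessU m q x - frameK m q p, frameK m q x + massMatrixInv m p) := by
  simp [matB, frameKT_eq, sub_eq_add_neg]

lemma matJB_apply (m : Fin n → ℝ) (q x p : Config n) : matJB m q (x, p) =
    (-(frameK m q x + massMatrixInv m p), -hessU m q x - frameK m q p) := by
  rw [matJB, LinearMap.comp_apply, matB_apply]
  simp [stdJ]

lemma matJB_mem_prod {m : Fin n → ℝ} (hm : ∀ i, 0 < m i) {q : Config n}
    {W : Submodule ℝ (Config n)}
    (hK : ∀ x ∈ W, frameK m q x ∈ W) (hU : ∀ x ∈ W, hessU m q x ∈ W.map (massMatrix m))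
    {z : Phase n} (hz : z ∈ W.prod (W.map (massMatrix m))) :
    matJB m q z ∈ W.prod (W.map (massMatrix m)) := by
  obtain ⟨x, p⟩ := z
  obtain ⟨hx, y, hy, rfl⟩ := hz
  have hinv : massMatrixInv m (massMatrix m y) = y := by
    ext1 i; simp [scaleBodies, smul_smul, (hm i).ne']
  rw [matJB_apply, hinv]
  refine ⟨neg_mem (add_mem (hK x hx) hy), sub_mem (neg_mem (hU x hx)) ?_⟩
  have : frameK m q (massMatrix m y) = massMatrix m (frameK m q y) :=
    (massMatrix_blockDiag m _ y).symm
  rw [this]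
  exact Submodule.mem_map_of_mem (hK y hy)

lemma sympForm_apply (z w : Phase n) : sympForm n z w = -⟪z.2, w.1⟫_ℝ + ⟪z.1, w.2⟫_ℝ := by
  simp [sympForm, phaseInner, stdJ]

lemma sympForm_matJB {m : Fin n → ℝ} {q : Config n} (hq : IsCentralConfiguration m q)
    (z w : Phase n) : sympForm n z (matJB m q w) = -sympForm n (matJB m q z) w := by
  obtain ⟨x, p⟩ := z
  obtain ⟨y, r⟩ := w
  rw [matJB_apply, matJB_apply, sympForm_apply, sympForm_apply]
  have h1 := hessU_symm m hq.collisionFree x y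
  have h2 := inner_frameK m q x r
  have h3 := inner_frameK m q p y
  have h4 := inner_massMatrix (fun i => (m i)⁻¹) p r
  simp only [inner_neg_right, inner_neg_left, inner_add_right, inner_add_left, inner_sub_left,
    inner_sub_right]
  linarith

/-- `E₃` is invariant under the linearized dynamics. -/
lemma matJB_mem_E₃ {m : Fin n → ℝ} (hm : ∀ i, 0 < m i) {q : Config n}
    (hq : IsCentralConfiguration m q) : ∀ z ∈ E₃ m q, matJB m q z ∈ E₃ m q := by
  intro z hz
  unfold E₃ at hz ⊢
  rw [LinearMap.BilinForm.mem_orthogonal_iff] at hz ⊢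
  intro w hw
  have h12 : matJB m q w ∈ E₁ m ⊔ E₂ m q := by
    obtain ⟨w1, h1, w2, h2, rfl⟩ := Submodule.mem_sup.mp hw
    rw [map_add]
    refine Submodule.add_mem_sup ?_ ?_
    · refine matJB_mem_prod hm (fun x hx => frameK_translations m q hx) (fun x hx => ?_) h1
      obtain ⟨v, rfl⟩ := translations_eq hx
      rw [hessU_translation hq]
      exact zero_mem _
    · exact matJB_mem_prod hm (fun x hx => frameK_rotationDirections m q hx)
        (fun x hx => hessU_rotationDirections hq hx) h2
  have h := hz _ h12
  change sympForm n (matJB m q w) z = 0 at h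
  change sympForm n w (matJB m q z) = 0
  rw [sympForm_matJB hq, h, neg_zero]

/-! ### Reduced system and stability -/

/-- `J B₃`, the restriction of `J B` to the invariant subspace `E₃`. -/
def matJB₃ {m : Fin n → ℝ} (hm : ∀ i, 0 < m i) {q : Config n}
    (hq : IsCentralConfiguration m q) : Module.End ℝ (E₃ m q) :=
  (matJB m q).restrict (matJB_mem_E₃ hm hq)

/-- The quadratic form `z ↦ ⟨B z, z⟩` of `B₃`, the restriction of `B` to `E₃`. -/
def formB₃ (m : Fin n → ℝ) (q : Config n) : QuadraticForm ℝ (E₃ m q) :=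
  (LinearMap.BilinMap.toQuadraticMap
    ((phaseInner n).comp (matB m q) LinearMap.id)).restrict (E₃ m q)

/-- The number `k`: `6` for a planar relative equilibrium generated by a non-collinear
configuration, and `4` otherwise. -/
def blockSize (m : Fin n → ℝ) (q : Config n) : ℕ :=
  open Classical in if IsPlanarRE m q ∧ ¬ IsCollinear q then 6 else 4

/-- The generalized kernel `ker (J B₃)^{8n-8-2k}`. -/
def generalizedKernel {m : Fin n → ℝ} (hm : ∀ i, 0 < m i) {q : Config n}
    (hq : IsCentralConfiguration m q) : Submodule ℝ (E₃ m q) :=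
  LinearMap.ker (matJB₃ hm hq ^ (8 * n - 8 - 2 * blockSize m q))

/-- The Morse index `n⁻` of the restriction of `B₃` to the generalized kernel of `J B₃`. -/
def indexOnGeneralizedKernel {m : Fin n → ℝ} (hm : ∀ i, 0 < m i) {q : Config n}
    (hq : IsCentralConfiguration m q) : ℕ :=
  sigNeg (R := ℝ) (M := generalizedKernel hm hq)
    ((formB₃ m q).restrict (generalizedKernel hm hq))

/-- The relative equilibrium is spectrally stable: all complex eigenvalues of `J B₃` are purely
imaginary. -/
def SpectrallyStable {m : Fin n → ℝ} (hm : ∀ i, 0 < m i) {q : Config n}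
    (hq : IsCentralConfiguration m q) : Prop :=
  ∀ μ : ℂ, Module.End.HasEigenvalue ((matJB₃ hm hq).baseChange ℂ) μ → μ.re = 0

/-- The relative equilibrium is linearly stable: it is spectrally stable and `J B₃` is
diagonalizable over `ℂ`. -/
def LinearlyStable {m : Fin n → ℝ} (hm : ∀ i, 0 < m i) {q : Config n}
    (hq : IsCentralConfiguration m q) : Prop :=
  SpectrallyStable hm hq ∧
    ⨆ μ : ℂ, Module.End.eigenspace ((matJB₃ hm hq).baseChange ℂ) μ = ⊤

/-- `J B₃` has a non-trivial Jordan block for the eigenvalue `0`. -/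
def HasNontrivialJordanBlockAtZero {m : Fin n → ℝ} (hm : ∀ i, 0 < m i) {q : Config n}
    (hq : IsCentralConfiguration m q) : Prop :=
  LinearMap.ker (matJB₃ hm hq) < LinearMap.ker (matJB₃ hm hq ^ 2)

end NBody

end

/-!
Replacing the momentum `p = M (y - K x)` by the velocity `y` turns the quadratic form of `B` into
`(-⟨D²U(q) x, x⟩ - ⟨MKx, Kx⟩) + ⟨My, y⟩`, and `z ∈ E₃` means that `x` and `y` lie in the
mass-orthogonal complement of the translations and of `V`. So `B₃` has the index and the nullity of
the first summand on that complement. Where `K = κ𝐢` this summand is minus the Hessian of `U` on the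
inertia ellipsoid. In a planar motion the directions normal to the plane `Π` split off: on them the
first summand is positive definite, while the Hessian consists of two isometric copies of the same
form, since the reflection exchanging two orthonormal vectors of `Πᗮ` fixes `q`. Modulo `2` neither
changes the count, and as `V` contains a `(k - 1)`-dimensional subspace of the kernel of the Hessian
with `k` even, the nullity of `B₃` has the parity of `n⁰(q) + 1` and its index that of
`n⁻(q) + n⁰(q) + 1`.

`JB₃` is an infinitesimally symplectic endomorphism of `E₃` with Hamiltonian `B₃`. If its eigenvalue
`0` is semisimple, its kernel is a symplectic subspace, so the nullity of `B₃` is even. If it has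
no nonzero real eigenvalue, then on the symplectic complement of the generalized kernel its
determinant and that of the symplectic form are positive, so the index of `B₃` is even there, and
its parity on `E₃` is its parity on the generalized kernel.
-/

noncomputable section

namespace NBody

open scoped InnerProductSpace

section Signature

section Isometry

variable {R E F : Type*} [CommRing R] [AddCommGroup E] [Module R E] [AddCommGroup F] [Module R F]

lemma equivalent_restrict_range {Q : QuadraticForm R E} {Q' : QuadraticForm R F} {f : E →ₗ[R] F}
    (hf : Function.Injective f) (hQ : ∀ x, Q' (f x) = Q x) :
    Q.Equivalent (Q'.restrict (LinearMap.range f)) :=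
  ⟨⟨LinearEquiv.ofInjective f hf, hQ⟩⟩

lemma equivalent_restrict_map {Q : QuadraticForm R E} {Q' : QuadraticForm R F} {f : E →ₗ[R] F}
    (hf : Function.Injective f) (S : Submodule R E) (hQ : ∀ x ∈ S, Q' (f x) = Q x) :
    (Q.restrict S).Equivalent (Q'.restrict (S.map f)) :=
  ⟨⟨S.equivMapOfInjective f hf, fun x => hQ x x.2⟩⟩

lemma equivalent_restrict_sup {Q : QuadraticForm R E} {S T : Submodule R E} (hd : Disjoint S T)
    (hST : ∀ x ∈ S, ∀ y ∈ T, QuadraticMap.polar Q x y = 0) :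
    ((Q.restrict S).prod (Q.restrict T)).Equivalent (Q.restrict (S ⊔ T)) := by
  rw [Submodule.sup_eq_range]
  refine equivalent_restrict_range ?_ fun x => ?_
  · rw [← LinearMap.ker_eq_bot, LinearMap.ker_coprod_of_disjoint_range _ _ (by simpa)]
    simp
  · have h := hST x.1 x.1.2 x.2 x.2.2
    rw [QuadraticMap.polar, sub_sub, sub_eq_zero] at h
    simpa using h

lemma equivalent_restrict_of_eq_top (Q : QuadraticForm R E) {S : Submodule R E} (hS : S = ⊤) :
    (Q.restrict S).Equivalent Q :=
  ⟨⟨LinearEquiv.ofTop S hS, fun _ => rfl⟩⟩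

end Isometry

section Radical

variable {𝕜 E F : Type*} [Field 𝕜] [NeZero (2 : 𝕜)]
  [AddCommGroup E] [Module 𝕜 E] [AddCommGroup F] [Module 𝕜 F]

lemma mem_radical_iff_polar {Q : QuadraticForm 𝕜 E} {x : E} :
    x ∈ Q.radical ↔ ∀ y, QuadraticMap.polar Q x y = 0 := by
  have : Invertible (2 : 𝕜) := invertibleOfNonzero two_ne_zero
  simp [QuadraticMap.radical_eq_ker_polarBilin, LinearMap.ext_iff]

lemma radical_neg (Q : QuadraticForm 𝕜 E) : (-Q).radical = Q.radical := by
  ext x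
  simp [mem_radical_iff_polar, QuadraticMap.polar_neg]

lemma radical_prod (Q₁ : QuadraticForm 𝕜 E) (Q₂ : QuadraticForm 𝕜 F) :
    (Q₁.prod Q₂).radical = Q₁.radical.prod Q₂.radical := by
  ext ⟨x, y⟩
  simp only [Submodule.mem_prod, mem_radical_iff_polar, Prod.forall, QuadraticMap.polar_prod]
  refine ⟨fun h => ⟨fun u => ?_, fun v => ?_⟩, fun h u v => by rw [h.1, h.2, add_zero]⟩
  · simpa using h u 0
  · simpa using h 0 v

lemma finrank_radical_prod [FiniteDimensional 𝕜 E] [FiniteDimensional 𝕜 F]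
    (Q₁ : QuadraticForm 𝕜 E) (Q₂ : QuadraticForm 𝕜 F) :
    Module.finrank 𝕜 (Q₁.prod Q₂).radical =
      Module.finrank 𝕜 Q₁.radical + Module.finrank 𝕜 Q₂.radical := by
  have h : Q₁.radical.prod Q₂.radical =
      LinearMap.range (Q₁.radical.subtype.prodMap Q₂.radical.subtype) := by
    simp [LinearMap.range_prodMap]
  rw [radical_prod, h, LinearMap.finrank_range_of_inj, Module.finrank_prod]
  exact Prod.map_injective.mpr ⟨Subtype.val_injective, Subtype.val_injective⟩

end Radical

section Index

variable {𝕜 E F : Type*} [Field 𝕜] [LinearOrder 𝕜]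
  [AddCommGroup E] [Module 𝕜 E] [AddCommGroup F] [Module 𝕜 F]
  [FiniteDimensional 𝕜 E] [FiniteDimensional 𝕜 F]

lemma sigPos_eq_finrank_of_posDef {Q : QuadraticForm 𝕜 E} (hQ : Q.PosDef) :
    sigPos Q = Module.finrank 𝕜 E := by
  refine (sigPos_le_finrank Q).antisymm ?_
  rw [← finrank_top 𝕜 E]
  exact le_sigPos_of_posDef Q fun x hx => hQ x (by simpa using hx)

variable [IsStrictOrderedRing 𝕜]

lemma sigPos_add_sigPos_le (Q₁ : QuadraticForm 𝕜 E) (Q₂ : QuadraticForm 𝕜 F) :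
    sigPos Q₁ + sigPos Q₂ ≤ sigPos (Q₁.prod Q₂) := by
  obtain ⟨V, hV, hQV⟩ := exists_finrank_eq_sigPos_and_posDef Q₁
  obtain ⟨W, hW, hQW⟩ := exists_finrank_eq_sigPos_and_posDef Q₂
  have hf : Function.Injective (V.subtype.prodMap W.subtype) :=
    Prod.map_injective.mpr ⟨Subtype.val_injective, Subtype.val_injective⟩
  rw [← hV, ← hW, ← Module.finrank_prod, ← LinearMap.finrank_range_of_inj hf]
  refine le_sigPos_of_posDef _ ?_
  rintro ⟨_, y, rfl⟩ hy
  exact hQV.prod hQW y fun hy0 => hy (by ext <;> simp [hy0])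

lemma sig_prod (Q₁ : QuadraticForm 𝕜 E) (Q₂ : QuadraticForm 𝕜 F) :
    sigPos (Q₁.prod Q₂) = sigPos Q₁ + sigPos Q₂ ∧ sigNeg (Q₁.prod Q₂) = sigNeg Q₁ + sigNeg Q₂ := by
  have hpos := sigPos_add_sigPos_le Q₁ Q₂
  have hneg : sigNeg Q₁ + sigNeg Q₂ ≤ sigNeg (Q₁.prod Q₂) := by
    have hprod : -(Q₁.prod Q₂) = (-Q₁).prod (-Q₂) := by
      ext x
      simp [add_comm]
    simpa only [← hprod, sigPos_neg] using sigPos_add_sigPos_le (-Q₁) (-Q₂)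
  have h₁ := QuadraticForm.sigPos_add_sigNeg_add_radical (Q := Q₁)
  have h₂ := QuadraticForm.sigPos_add_sigNeg_add_radical (Q := Q₂)
  have h := QuadraticForm.sigPos_add_sigNeg_add_radical (Q := Q₁.prod Q₂)
  rw [Module.finrank_prod, finrank_radical_prod] at h
  omega

lemma sigPos_prod (Q₁ : QuadraticForm 𝕜 E) (Q₂ : QuadraticForm 𝕜 F) :
    sigPos (Q₁.prod Q₂) = sigPos Q₁ + sigPos Q₂ :=
  (sig_prod Q₁ Q₂).1

lemma sigNeg_prod (Q₁ : QuadraticForm 𝕜 E) (Q₂ : QuadraticForm 𝕜 F) :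
    sigNeg (Q₁.prod Q₂) = sigNeg Q₁ + sigNeg Q₂ :=
  (sig_prod Q₁ Q₂).2

lemma sigNeg_eq_zero_of_posDef {Q : QuadraticForm 𝕜 E} (hQ : Q.PosDef) : sigNeg Q = 0 := by
  have := QuadraticForm.sigPos_add_sigNeg_add_radical (Q := Q)
  rw [sigPos_eq_finrank_of_posDef hQ] at this
  omega

lemma finrank_radical_eq_zero_of_posDef {Q : QuadraticForm 𝕜 E} (hQ : Q.PosDef) :
    Module.finrank 𝕜 Q.radical = 0 := by
  have := QuadraticForm.sigPos_add_sigNeg_add_radical (Q := Q)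
  rw [sigPos_eq_finrank_of_posDef hQ] at this
  omega

end Index

end Signature

section Parity

open scoped Matrix

variable {ι : Type*} [Fintype ι] {E : Type*} [AddCommGroup E] [Module ℝ E]

lemma det_pos_of_forall_nonpos_not_hasEigenvalue [FiniteDimensional ℝ E] {f : Module.End ℝ E}
    (hf : ∀ c ≤ 0, ¬ f.HasEigenvalue c) : 0 < LinearMap.det f := by
  have heval : (-f).charpoly.eval 0 = LinearMap.det f := by simp [LinearMap.eval_charpoly]
  rw [← heval]
  refine Polynomial.zero_lt_eval_of_roots_lt_of_leadingCoeff_nonneg (fun c hc => ?_) ?_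
  · rw [← Module.End.hasEigenvalue_iff_isRoot_charpoly, Module.End.hasEigenvalue_neg_iff] at hc
    by_contra! hc0
    exact hf (-c) (neg_nonpos.mpr hc0) hc
  · rw [(LinearMap.charpoly_monic _).leadingCoeff]
    exact zero_le_one

lemma even_finrank_of_forall_not_hasEigenvalue [FiniteDimensional ℝ E] {f : Module.End ℝ E}
    (hf : ∀ c, ¬ f.HasEigenvalue c) : Even (Module.finrank ℝ E) := by
  have hpos := det_pos_of_forall_nonpos_not_hasEigenvalue fun c _ => hf c
  have hneg : 0 < LinearMap.det (-f) := det_pos_of_forall_nonpos_not_hasEigenvalue fun c _ => by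
    rw [Module.End.hasEigenvalue_neg_iff]
    exact hf (-c)
  rw [← neg_one_smul ℝ f, LinearMap.det_smul] at hneg
  by_contra hodd
  rw [(Nat.not_even_iff_odd.mp hodd).neg_one_pow] at hneg
  linarith

lemma even_ncard_neg_of_prod_pos {w : ι → ℝ} (h : 0 < ∏ i, w i) : Even {i | w i < 0}.ncard := by
  classical
  have hw : ∀ i, w i = (if w i < 0 then -1 else 1) * |w i| := fun i => by
    split_ifs with hi
    · rw [abs_of_neg hi, neg_one_mul, neg_neg]
    · rw [abs_of_nonneg (not_lt.mp hi), one_mul]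
  rw [Finset.prod_congr rfl fun i _ => hw i, Finset.prod_mul_distrib, Finset.prod_ite,
    Finset.prod_const, Finset.prod_const_one, mul_one] at h
  rw [Set.ncard_eq_toFinset_card', Set.toFinset_ofPred]
  by_contra hodd
  rw [(Nat.not_even_iff_odd.mp hodd).neg_one_pow] at h
  have := Finset.prod_nonneg fun i (_ : i ∈ Finset.univ) => abs_nonneg (w i)
  linarith

lemma not_hasEigenvalue_toLin'_of_dotProduct_mulVec_eq_zero [DecidableEq ι] {M : Matrix ι ι ℝ}
    (hM : M.det ≠ 0) (h : ∀ v, v ⬝ᵥ M *ᵥ v = 0) (c : ℝ) :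
    ¬ Module.End.HasEigenvalue (Matrix.toLin' M) c := by
  intro hc
  obtain ⟨v, hv, hv0⟩ := hc.exists_hasEigenvector
  rw [Module.End.mem_eigenspace_iff, Matrix.toLin'_apply] at hv
  have hcv : c * (v ⬝ᵥ v) = 0 := by rw [← smul_eq_mul, ← dotProduct_smul, ← hv, h]
  rcases mul_eq_zero.mp hcv with rfl | hvv
  · rw [zero_smul] at hv
    exact hv0 (Matrix.eq_zero_of_mulVec_eq_zero hM hv)
  · exact hv0 (dotProduct_self_eq_zero.mp hvv)

variable {ω : LinearMap.BilinForm ℝ E}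

lemma not_hasEigenvalue_toLin'_toMatrix_of_isAlt (hω : ω.IsAlt) (hnd : ω.Nondegenerate)
    [DecidableEq ι] (b : Module.Basis ι ℝ E) (c : ℝ) :
    ¬ Module.End.HasEigenvalue (Matrix.toLin' (LinearMap.BilinForm.toMatrix b ω)) c := by
  refine not_hasEigenvalue_toLin'_of_dotProduct_mulVec_eq_zero
    ((LinearMap.BilinForm.nondegenerate_iff_det_ne_zero b).mp hnd) (fun v => ?_) c
  rw [LinearMap.BilinForm.dotProduct_toMatrix_mulVec, hω.self_eq_zero]

lemma det_toMatrix_pos_of_isAlt (hω : ω.IsAlt) (hnd : ω.Nondegenerate) [DecidableEq ι]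
    (b : Module.Basis ι ℝ E) : 0 < (LinearMap.BilinForm.toMatrix b ω).det := by
  rw [← LinearMap.det_toLin']
  exact det_pos_of_forall_nonpos_not_hasEigenvalue fun c _ =>
    not_hasEigenvalue_toLin'_toMatrix_of_isAlt hω hnd b c

lemma even_finrank_of_isAlt [FiniteDimensional ℝ E] (hω : ω.IsAlt) (hnd : ω.Nondegenerate) :
    Even (Module.finrank ℝ E) := by
  simpa using even_finrank_of_forall_not_hasEigenvalue
    (not_hasEigenvalue_toLin'_toMatrix_of_isAlt hω hnd (Module.finBasis ℝ E))

end Parity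

section Hamiltonian

variable {R E : Type*} [CommRing R] [AddCommGroup E] [Module R E]

/-- The Hamiltonian `x ↦ -ω (A x, x)` of the linear vector field `A` with respect to the
symplectic form `ω`. -/
def hamiltonianForm (ω : LinearMap.BilinForm R E) (A : Module.End R E) : QuadraticForm R E :=
  (-ω.compLeft A).toQuadraticMap

variable {ω : LinearMap.BilinForm R E} {A : Module.End R E}

lemma apply_comm_of_isSkewAdjoint (hω : ω.IsAlt) (hA : ω.IsSkewAdjoint A) (x y : E) :
    ω (A x) y = ω (A y) x := by
  rw [hA x y, Pi.neg_apply, map_neg, hω.neg_eq]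

lemma associated_hamiltonianForm [Invertible (2 : R)] (hω : ω.IsAlt) (hA : ω.IsSkewAdjoint A) :
    QuadraticMap.associated (hamiltonianForm ω A) = -ω.compLeft A :=
  QuadraticMap.associated_left_inverse _ fun x y =>
    congrArg Neg.neg (apply_comm_of_isSkewAdjoint hω hA x y)

end Hamiltonian

lemma even_sigNeg_hamiltonianForm_of_forall_not_hasEigenvalue {E : Type*} [AddCommGroup E]
    [Module ℝ E] [FiniteDimensional ℝ E] {ω : LinearMap.BilinForm ℝ E} {A : Module.End ℝ E}
    (hω : ω.IsAlt) (hnd : ω.Nondegenerate) (hA : ω.IsSkewAdjoint A)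
    (hev : ∀ c, ¬ A.HasEigenvalue c) : Even (sigNeg (hamiltonianForm ω A)) := by
  have : Invertible (2 : ℝ) := invertibleOfNonzero two_ne_zero
  obtain ⟨v, hv⟩ := LinearMap.BilinForm.exists_orthogonal_basis
    (QuadraticForm.associated_isSymm ℝ (hamiltonianForm ω A))
  rw [QuadraticForm.sigNeg_of_equiv_weightedSumSquares
    ⟨(hamiltonianForm ω A).isometryEquivWeightedSumSquares v hv⟩]
  apply even_ncard_neg_of_prod_pos
  have hgram : Matrix.diagonal (fun i => hamiltonianForm ω A (v i)) =
      -((LinearMap.toMatrix v v A).transpose * LinearMap.BilinForm.toMatrix v ω) := by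
    ext i j
    rw [Matrix.neg_apply, ← LinearMap.BilinForm.toMatrix_compLeft,
      LinearMap.BilinForm.toMatrix_apply]
    obtain rfl | hij := eq_or_ne i j
    · exact Matrix.diagonal_apply_eq _ _
    · rw [Matrix.diagonal_apply_ne _ hij]
      rw [associated_hamiltonianForm hω hA] at hv
      exact (hv hij).symm
  have hdetA : 0 < (LinearMap.toMatrix v v A).det := by
    rw [LinearMap.det_toMatrix]
    exact det_pos_of_forall_nonpos_not_hasEigenvalue fun c _ => hev c
  rw [← Matrix.det_diagonal, hgram, Matrix.det_neg, Fintype.card_fin,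
    (even_finrank_of_isAlt hω hnd).neg_one_pow, one_mul, Matrix.det_mul, Matrix.det_transpose]
  exact mul_pos hdetA (det_toMatrix_pos_of_isAlt hω hnd v)

section Fitting

open scoped TensorProduct

variable {K E : Type*} [Field K] [AddCommGroup E] [Module K E]
  {f : Module.End K E}

lemma isCompl_ker_range_of_ker_sq_le [FiniteDimensional K E]
    (hf : LinearMap.ker (f ^ 2) ≤ LinearMap.ker f) :
    IsCompl (LinearMap.ker f) (LinearMap.range f) := by
  rw [Submodule.isCompl_iff_disjoint _ _ (by rw [add_comm, f.finrank_range_add_finrank_ker]),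
    Submodule.disjoint_def]
  rintro _ hx ⟨y, rfl⟩
  exact hf (by rwa [LinearMap.mem_ker, pow_two])

lemma isCompl_ker_range_pow_finrank [FiniteDimensional K E] (f : Module.End K E) :
    IsCompl (LinearMap.ker (f ^ Module.finrank K E)) (LinearMap.range (f ^ Module.finrank K E)) :=
  isCompl_ker_range_of_ker_sq_le (by rw [← pow_mul]; exact f.ker_pow_le_ker_pow_finrank _)

lemma apply_mem_range_pow {e : ℕ} {x : E} (hx : x ∈ LinearMap.range (f ^ e)) :
    f x ∈ LinearMap.range (f ^ e) := by
  obtain ⟨y, rfl⟩ := hx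
  exact ⟨f y, by rw [← Module.End.mul_apply, ← Module.End.mul_apply, ← pow_succ, ← pow_succ']⟩

lemma hasEigenvalue_baseChange [FiniteDimensional K E] (L : Type*) [Field L] [Algebra K L] {c : K}
    (hc : f.HasEigenvalue c) : Module.End.HasEigenvalue (f.baseChange L) (algebraMap K L c) := by
  rw [Module.End.hasEigenvalue_iff_isRoot_charpoly] at hc ⊢
  rw [LinearMap.charpoly_baseChange]
  exact hc.map

lemma ker_sq_le_of_iSup_eigenspace_baseChange_eq_top {L : Type*} [Field L] [Algebra K L]
    (h : ⨆ μ, Module.End.eigenspace (f.baseChange L) μ = ⊤) :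
    LinearMap.ker (f ^ 2) ≤ LinearMap.ker f := by
  have hle : Module.End.eigenspace (f.baseChange L) ≤
      Module.End.maxGenEigenspace (f.baseChange L) := fun μ =>
    (Module.End.genEigenspace _ μ).mono le_top
  have heq := ((Module.End.independent_maxGenEigenspace _).le_iff_eq_of_iSup_eq_top h).mp hle
  intro x hx
  have hmem : (1 : L) ⊗ₜ[K] x ∈ Module.End.maxGenEigenspace (f.baseChange L) 0 := by
    rw [Module.End.mem_maxGenEigenspace]
    refine ⟨2, ?_⟩
    rw [zero_smul, sub_zero (f.baseChange L), ← LinearMap.baseChange_pow, LinearMap.baseChange_tmul,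
      LinearMap.mem_ker.mp hx, TensorProduct.tmul_zero]
  rw [← heq, Module.End.mem_eigenspace_iff, zero_smul, LinearMap.baseChange_tmul] at hmem
  simpa using hmem

end Fitting

section Symplectic

variable {K E : Type*} [Field K] [AddCommGroup E] [Module K E]
  {ω : LinearMap.BilinForm K E} {A : Module.End K E}

lemma orthogonal_range_of_isAdjointPair (hnd : ω.Nondegenerate) {f g : Module.End K E}
    (hfg : LinearMap.IsAdjointPair ω ω f g) :
    ω.orthogonal (LinearMap.range f) = LinearMap.ker g := by
  ext x
  simp only [LinearMap.BilinForm.mem_orthogonal_iff, LinearMap.mem_range, forall_exists_index,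
    forall_apply_eq_imp_iff, LinearMap.mem_ker, hfg _ x]
  exact ⟨hnd.2 _, fun h y => by rw [h, map_zero]⟩

lemma orthogonal_range (hnd : ω.Nondegenerate) (hA : ω.IsSkewAdjoint A) :
    ω.orthogonal (LinearMap.range A) = LinearMap.ker A := by
  rw [orthogonal_range_of_isAdjointPair (g := -A) hnd hA, LinearMap.ker_neg]

lemma isAdjointPair_pow (hA : ω.IsSkewAdjoint A) (e : ℕ) :
    LinearMap.IsAdjointPair ω ω ⇑(A ^ e) ⇑((-A) ^ e) := by
  induction e with
  | zero => exact fun _ _ => rfl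
  | succ e ih =>
    have := ih.mul (f' := A) (g' := -A) hA
    rwa [← pow_succ, ← pow_succ'] at this

lemma orthogonal_range_pow (hnd : ω.Nondegenerate) (hA : ω.IsSkewAdjoint A) (e : ℕ) :
    ω.orthogonal (LinearMap.range (A ^ e)) = LinearMap.ker (A ^ e) := by
  rw [orthogonal_range_of_isAdjointPair hnd (isAdjointPair_pow hA e)]
  rcases Nat.even_or_odd e with he | he
  · rw [he.neg_pow]
  · rw [he.neg_pow, LinearMap.ker_neg]

lemma radical_hamiltonianForm [NeZero (2 : K)] (hω : ω.IsAlt) (hnd : ω.Nondegenerate)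
    (hA : ω.IsSkewAdjoint A) : (hamiltonianForm ω A).radical = LinearMap.ker A := by
  have : Invertible (2 : K) := invertibleOfNonzero two_ne_zero
  ext x
  rw [QuadraticMap.radical_eq_ker_associated, associated_hamiltonianForm hω hA,
    LinearMap.mem_ker, LinearMap.mem_ker, LinearMap.neg_apply, neg_eq_zero]
  refine ⟨fun h => hnd.1 _ fun y => LinearMap.congr_fun h y, fun h => ?_⟩
  ext y
  simp [LinearMap.BilinForm.compLeft_apply, h]

end Symplectic

section SymplecticParity

variable {E : Type*} [AddCommGroup E] [Module ℝ E] [FiniteDimensional ℝ E]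
  {ω : LinearMap.BilinForm ℝ E} {A : Module.End ℝ E}

lemma even_finrank_ker_of_ker_sq_le (hω : ω.IsAlt) (hnd : ω.Nondegenerate)
    (hA : ω.IsSkewAdjoint A) (hker : LinearMap.ker (A ^ 2) ≤ LinearMap.ker A) :
    Even (Module.finrank ℝ (LinearMap.ker A)) := by
  have hrange : (ω.restrict (LinearMap.range A)).Nondegenerate := by
    rw [LinearMap.BilinForm.restrict_nondegenerate_iff_isCompl_orthogonal hω.isRefl,
      orthogonal_range hnd hA]
    exact (isCompl_ker_range_of_ker_sq_le hker).symm
  have heven := even_finrank_of_isAlt hω hnd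
  rw [← A.finrank_range_add_finrank_ker, Nat.even_add] at heven
  exact heven.mp (even_finrank_of_isAlt (fun x => hω x) hrange)

lemma even_sigNeg_hamiltonianForm_restrict (hω : ω.IsAlt) (hA : ω.IsSkewAdjoint A)
    {S : Submodule ℝ E} (hnd : (ω.restrict S).Nondegenerate) (hAS : ∀ x ∈ S, A x ∈ S)
    (hev : ∀ (c : ℝ), ∀ x ∈ S, A x = c • x → x = 0) :
    Even (sigNeg ((hamiltonianForm ω A).restrict S)) := by
  have heq : (hamiltonianForm ω A).restrict S =
      hamiltonianForm (ω.restrict S) (A.restrict hAS) := rfl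
  rw [heq]
  refine even_sigNeg_hamiltonianForm_of_forall_not_hasEigenvalue (fun x => hω x) hnd
    (fun x y => hA x y) fun c hc => ?_
  obtain ⟨x, hx, hx0⟩ := hc.exists_hasEigenvector
  exact hx0 (Subtype.ext (hev c x x.2
    (congrArg Subtype.val (Module.End.mem_eigenspace_iff.mp hx))))

lemma even_sigNeg_hamiltonianForm_restrict_range (hω : ω.IsAlt) (hnd : ω.Nondegenerate)
    (hA : ω.IsSkewAdjoint A) (hev : ∀ c ≠ 0, ¬ A.HasEigenvalue c) :
    Even (sigNeg ((hamiltonianForm ω A).restrict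
      (LinearMap.range (A ^ Module.finrank ℝ E)))) := by
  have hcompl := isCompl_ker_range_pow_finrank A
  refine even_sigNeg_hamiltonianForm_restrict hω hA ?_ (fun _ => apply_mem_range_pow)
    fun c x hx hAx => ?_
  · rw [LinearMap.BilinForm.restrict_nondegenerate_iff_isCompl_orthogonal hω.isRefl,
      orthogonal_range_pow hnd hA]
    exact hcompl.symm
  · obtain rfl | hc := eq_or_ne c 0
    · have hker : x ∈ LinearMap.ker (A ^ 1) := by rwa [zero_smul] at hAx
      exact Submodule.disjoint_def.mp hcompl.disjoint x (A.ker_pow_le_ker_pow_finrank 1 hker) hx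
    · by_contra hx0
      exact hev c hc (Module.End.hasEigenvalue_of_hasEigenvector
        ⟨Module.End.mem_eigenspace_iff.mpr hAx, hx0⟩)

lemma even_sigNeg_hamiltonianForm_iff (hω : ω.IsAlt) (hnd : ω.Nondegenerate)
    (hA : ω.IsSkewAdjoint A) (hev : ∀ c ≠ 0, ¬ A.HasEigenvalue c) :
    Even (sigNeg (hamiltonianForm ω A)) ↔
      Even (sigNeg ((hamiltonianForm ω A).restrict
        (LinearMap.ker (A ^ Module.finrank ℝ E)))) := by
  have hcompl := isCompl_ker_range_pow_finrank A
  have hpolar : ∀ x ∈ LinearMap.ker (A ^ Module.finrank ℝ E),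
      ∀ y ∈ LinearMap.range (A ^ Module.finrank ℝ E),
      QuadraticMap.polar (hamiltonianForm ω A) x y = 0 := by
    intro x hx y hy
    rw [← orthogonal_range_pow hnd hA, LinearMap.BilinForm.mem_orthogonal_iff] at hx
    have hyx : ω (A y) x = 0 := hx _ (apply_mem_range_pow hy)
    rw [hamiltonianForm, LinearMap.BilinMap.polar_toQuadraticMap]
    simp [LinearMap.BilinForm.compLeft_apply, apply_comm_of_isSkewAdjoint hω hA x y, hyx]
  have hsplit := (equivalent_restrict_sup hcompl.disjoint hpolar).trans
    (equivalent_restrict_of_eq_top _ hcompl.sup_eq_top)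
  rw [← hsplit.sigNeg_eq, sigNeg_prod, Nat.even_add]
  exact iff_true_right (even_sigNeg_hamiltonianForm_restrict_range hω hnd hA hev)

end SymplecticParity

section SkewAdjoint

variable {V : Type*} [NormedAddCommGroup V] [InnerProductSpace ℝ V]

lemma mem_skewAdjointSubmodule_innerₗ {a : Module.End ℝ V} :
    a ∈ (innerₗ V).skewAdjointSubmodule ↔ ∀ x y, ⟪a x, y⟫_ℝ = -⟪x, a y⟫_ℝ := by
  simp [LinearMap.mem_skewAdjointSubmodule, LinearMap.IsSkewAdjoint, LinearMap.IsAdjointPair]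

variable {ι : Type*} [Fintype ι] [LinearOrder ι]

/-- The entries above the diagonal of the matrix of a skew map in an orthonormal basis. -/
def skewEntries (b : OrthonormalBasis ι ℝ V) :
    (innerₗ V).skewAdjointSubmodule →ₗ[ℝ] {p : ι × ι // p.1 < p.2} → ℝ where
  toFun a p := ⟪a.1 (b p.1.1), b p.1.2⟫_ℝ
  map_add' a a' := by ext; simp [inner_add_left]
  map_smul' c a := by ext; simp [inner_smul_left]

lemma skewEntries_injective (b : OrthonormalBasis ι ℝ V) :
    Function.Injective (skewEntries b) := by
  refine (injective_iff_map_eq_zero _).mpr fun a ha => Subtype.ext (b.toBasis.ext fun i => ?_)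
  have hskew := mem_skewAdjointSubmodule_innerₗ.mp a.2
  have hlt : ∀ i j, i < j → ⟪a.1 (b i), b j⟫_ℝ = 0 := fun i j hij => congrFun ha ⟨(i, j), hij⟩
  refine InnerProductSpace.ext_inner_right_basis b.toBasis fun j => ?_
  simp only [OrthonormalBasis.coe_toBasis, ZeroMemClass.coe_zero, LinearMap.zero_apply,
    inner_zero_left]
  rcases lt_trichotomy i j with hij | rfl | hij
  · exact hlt i j hij
  · linarith [hskew (b i) (b i), real_inner_comm (b i) (a.1 (b i))]
  · rw [hskew, real_inner_comm, hlt j i hij, neg_zero]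

lemma skewEntries_surjective (b : OrthonormalBasis ι ℝ V) :
    Function.Surjective (skewEntries b) := by
  intro c
  let M : ι → ι → ℝ := fun i j =>
    if h : i < j then c ⟨(i, j), h⟩ else if h : j < i then -c ⟨(j, i), h⟩ else 0
  have hM : ∀ i j, M i j = -M j i := by
    intro i j
    rcases lt_trichotomy i j with hij | rfl | hij
    · simp [M, hij, hij.not_gt]
    · simp [M]
    · simp [M, hij, hij.not_gt]
  let a := Matrix.toLin b.toBasis b.toBasis (.of fun j i => M i j)
  have ha : ∀ i j, ⟪a (b i), b j⟫_ℝ = M i j := by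
    intro i j
    rw [← b.coe_toBasis, Matrix.toLin_self, sum_inner]
    simp [inner_smul_left, OrthonormalBasis.inner_eq_ite]
  have hskew : a ∈ (innerₗ V).skewAdjointSubmodule := by
    have hbilin : (innerₗ V) ∘ₗ a = -(innerₗ V).compl₂ a :=
      b.toBasis.ext fun i => b.toBasis.ext fun j => by
        simpa [ha, real_inner_comm (a (b j))] using hM i j
    exact mem_skewAdjointSubmodule_innerₗ.mpr fun x y =>
      LinearMap.congr_fun (LinearMap.congr_fun hbilin x) y
  refine ⟨⟨a, hskew⟩, funext fun p => ?_⟩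
  exact (ha _ _).trans (dif_pos p.2)

lemma card_lt_eq_choose (d : ℕ) :
    Fintype.card {p : Fin d × Fin d // p.1 < p.2} = d.choose 2 := by
  calc Fintype.card {p : Fin d × Fin d // p.1 < p.2}
      = ∑ j : Fin d, (Finset.Iio j).card := by
        rw [Fintype.card_subtype, Finset.card_filter, Fintype.sum_prod_type_right]
        simp [Finset.filter_gt_eq_Iio]
    _ = d.choose 2 := by
        simp only [Fin.card_Iio, Fin.sum_univ_eq_sum_range (fun j => j), Finset.sum_range_id,
          Nat.choose_two_right]

lemma finrank_skewAdjointSubmodule [FiniteDimensional ℝ V] :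
    Module.finrank ℝ (innerₗ V).skewAdjointSubmodule = (Module.finrank ℝ V).choose 2 := by
  let b := stdOrthonormalBasis ℝ V
  rw [(LinearEquiv.ofBijective (skewEntries b)
    ⟨skewEntries_injective b, skewEntries_surjective b⟩).finrank_eq,
    Module.finrank_fintype_fun_eq_card, card_lt_eq_choose]

/-- Extension of a skew map of a subspace by zero on the orthogonal complement. -/
def skewExtension (S : Submodule ℝ V) [S.HasOrthogonalProjection] :
    (innerₗ S).skewAdjointSubmodule →ₗ[ℝ] (innerₗ V).skewAdjointSubmodule where
  toFun c := ⟨S.subtype ∘ₗ c.1 ∘ₗ S.orthogonalProjectionOnto.toLinearMap,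
    mem_skewAdjointSubmodule_innerₗ.mpr fun x y => by
      have hskew := mem_skewAdjointSubmodule_innerₗ.mp c.2 (S.orthogonalProjectionOnto x)
        (S.orthogonalProjectionOnto y)
      rwa [S.inner_orthogonalProjectionOnto_eq_of_mem_left,
        S.inner_orthogonalProjectionOnto_eq_of_mem_right] at hskew⟩
  map_add' c c' := by ext; simp
  map_smul' t c := by ext; simp

lemma skewExtension_apply (S : Submodule ℝ V) [S.HasOrthogonalProjection]
    (c : (innerₗ S).skewAdjointSubmodule) (x : V) :
    (skewExtension S c).1 x = c.1 (S.orthogonalProjectionOnto x) := rfl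

lemma skewExtension_injective (S : Submodule ℝ V) [S.HasOrthogonalProjection] :
    Function.Injective (skewExtension S) := by
  intro c c' h
  ext x
  have hx := LinearMap.congr_fun (congrArg Subtype.val h) (x : V)
  simpa only [skewExtension_apply, Submodule.orthogonalProjectionOnto_mem_subspace_eq_self] using hx

lemma mem_range_skewExtension {S : Submodule ℝ V} [S.HasOrthogonalProjection]
    {a : (innerₗ V).skewAdjointSubmodule} :
    a ∈ LinearMap.range (skewExtension S) ↔ ∀ x ∈ Sᗮ, a.1 x = 0 := by
  constructor
  · rintro ⟨c, rfl⟩ x hx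
    rw [skewExtension_apply, Submodule.orthogonalProjectionOnto_apply_of_mem_orthogonal hx,
      map_zero, Submodule.coe_zero]
  · intro ha
    have hskew := mem_skewAdjointSubmodule_innerₗ.mp a.2
    have hS : ∀ x, a.1 x ∈ S := fun x => by
      rw [← S.orthogonal_orthogonal, Submodule.mem_orthogonal']
      exact fun y hy => by rw [hskew, ha y hy, inner_zero_right, neg_zero]
    refine ⟨⟨(a.1.codRestrict S hS).comp S.subtype,
      mem_skewAdjointSubmodule_innerₗ.mpr fun x y => hskew x y⟩,
      Subtype.ext (LinearMap.ext fun x => ?_)⟩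
    have hx := ha _ (S.sub_starProjection_mem_orthogonal x)
    rw [map_sub, sub_eq_zero] at hx
    exact hx.symm

end SkewAdjoint

section Orbit

variable {n : ℕ} {q : Config n}

lemma blockDiag_apply (a : E4 →ₗ[ℝ] E4) (x : Config n) (i : Fin n) :
    blockDiag n a x i = a (x i) := rfl

lemma isSkew_iff_mem_skewAdjointSubmodule {a : E4 →ₗ[ℝ] E4} :
    IsSkew a ↔ a ∈ (innerₗ E4).skewAdjointSubmodule :=
  mem_skewAdjointSubmodule_innerₗ.symm

lemma blockDiag_mem_orbitTangent (q : Config n) {a : E4 →ₗ[ℝ] E4} (ha : IsSkew a) :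
    blockDiag n a q ∈ orbitTangent q := by
  obtain ⟨A, rfl⟩ := Matrix.toEuclideanLin.surjective a
  refine Submodule.subset_span ⟨A, (LieAlgebra.Orthogonal.mem_so _ _ A).mpr ?_, rfl⟩
  have hadj : -Matrix.toEuclideanLin A = LinearMap.adjoint (Matrix.toEuclideanLin A) :=
    (LinearMap.eq_adjoint_iff _ _).mpr fun x y => by
      rw [LinearMap.neg_apply, inner_neg_left, ha, neg_neg]
  rw [← Matrix.toEuclideanLin_conjTranspose_eq_adjoint, ← map_neg] at hadj
  simpa using (Matrix.toEuclideanLin.injective hadj).symm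

/-- The infinitesimal action `a ↦ a q` of the skew maps of `ℝ⁴` at the configuration `q`. -/
def orbitMap (q : Config n) : (innerₗ E4).skewAdjointSubmodule →ₗ[ℝ] Config n where
  toFun a := blockDiag n a.1 q
  map_add' a b := by ext; rfl
  map_smul' c a := by ext; rfl

lemma range_orbitMap (q : Config n) : LinearMap.range (orbitMap q) = orbitTangent q := by
  refine le_antisymm ?_ fun x hx => ?_
  · rintro _ ⟨a, rfl⟩
    exact blockDiag_mem_orbitTangent q (isSkew_iff_mem_skewAdjointSubmodule.mpr a.2)
  · obtain ⟨a, ha, rfl⟩ := orbitTangent_eq hx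
    exact ⟨⟨a, isSkew_iff_mem_skewAdjointSubmodule.mp ha⟩, rfl⟩

lemma ker_orbitMap (q : Config n) :
    LinearMap.ker (orbitMap q) =
      LinearMap.range (skewExtension (Submodule.span ℝ (Set.range q))ᗮ) := by
  ext a
  rw [mem_range_skewExtension, Submodule.orthogonal_orthogonal, LinearMap.mem_ker]
  change _ ↔ Submodule.span ℝ (Set.range q) ≤ LinearMap.ker a.1
  rw [Submodule.span_le, Set.range_subset_iff]
  exact ⟨fun h i => congrArg (fun x : Config n => x i) h, fun h => PiLp.ext h⟩

lemma finrank_orbitTangent_add_choose (q : Config n) :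
    Module.finrank ℝ (orbitTangent q) +
      (4 - Module.finrank ℝ (Submodule.span ℝ (Set.range q))).choose 2 = 6 := by
  have h := (orbitMap q).finrank_range_add_finrank_ker
  have hcompl := (Submodule.span ℝ (Set.range q)).finrank_add_finrank_orthogonal
  rw [finrank_euclideanSpace_fin] at hcompl
  rw [range_orbitMap, ker_orbitMap, LinearMap.finrank_range_of_inj (skewExtension_injective _),
    finrank_skewAdjointSubmodule, finrank_skewAdjointSubmodule, finrank_euclideanSpace_fin] at h
  rw [← Nat.sub_eq_of_eq_add' hcompl.symm] at h
  exact h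

lemma finrank_orbitTangent_of_not_planar (hq : ¬ IsPlanar q) :
    Module.finrank ℝ (orbitTangent q) = 6 := by
  have h := finrank_orbitTangent_add_choose q
  rwa [Nat.choose_eq_zero_of_lt (by unfold IsPlanar at hq; omega)] at h

lemma finrank_orbitTangent_of_planar (hq : IsPlanar q) (hq' : ¬ IsCollinear q) :
    Module.finrank ℝ (orbitTangent q) = 5 := by
  have h := finrank_orbitTangent_add_choose q
  have hrank : Module.finrank ℝ (Submodule.span ℝ (Set.range q)) = 2 := by
    unfold IsPlanar at hq
    unfold IsCollinear at hq'
    omega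
  norm_num [hrank] at h
  omega

lemma finrank_orbitTangent_of_collinear (hq : q ≠ 0) (hq' : IsCollinear q) :
    Module.finrank ℝ (orbitTangent q) = 3 := by
  have h := finrank_orbitTangent_add_choose q
  have hspan : Submodule.span ℝ (Set.range q) ≠ ⊥ := fun hbot =>
    hq (PiLp.ext fun i => Submodule.span_eq_bot.mp hbot _ ⟨i, rfl⟩)
  have hrank : Module.finrank ℝ (Submodule.span ℝ (Set.range q)) = 1 :=
    le_antisymm hq' (Submodule.one_le_finrank_iff.mpr hspan)
  norm_num [hrank] at h
  omega

end Orbit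

section Mass

variable {n : ℕ} {m : Fin n → ℝ}

lemma massMatrixInv_massMatrix (hm : ∀ i, 0 < m i) (x : Config n) :
    massMatrixInv m (massMatrix m x) = x := by
  ext1 i
  simp [scaleBodies, smul_smul, (hm i).ne']

lemma massMatrix_massMatrixInv (hm : ∀ i, 0 < m i) (x : Config n) :
    massMatrix m (massMatrixInv m x) = x := by
  ext1 i
  simp [scaleBodies, smul_smul, (hm i).ne']

lemma massMatrix_injective (hm : ∀ i, 0 < m i) : Function.Injective (massMatrix m) :=
  Function.LeftInverse.injective (massMatrixInv_massMatrix hm)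

/-- The mass scalar product `⟨Mx, y⟩` on configurations. -/
def massInner (m : Fin n → ℝ) : LinearMap.BilinForm ℝ (Config n) :=
  (innerₗ (Config n)).comp (massMatrix m)

lemma massInner_apply (m : Fin n → ℝ) (x y : Config n) :
    massInner m x y = ∑ i, m i * ⟪x i, y i⟫_ℝ := by
  change ⟪massMatrix m x, y⟫_ℝ = _
  simp [inner_config, scaleBodies, inner_smul_left]

lemma massInner_isSymm (m : Fin n → ℝ) : (massInner m).IsSymm :=
  ⟨fun x y => by simp only [massInner_apply, real_inner_comm]⟩

lemma massInner_self_pos (hm : ∀ i, 0 < m i) {x : Config n} (hx : x ≠ 0) :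
    0 < massInner m x x := by
  obtain ⟨i, hi⟩ : ∃ i, x i ≠ 0 := by
    by_contra! h
    exact hx (PiLp.ext h)
  rw [massInner_apply]
  exact Finset.sum_pos' (fun i _ => mul_nonneg (hm i).le real_inner_self_nonneg)
    ⟨i, Finset.mem_univ _, mul_pos (hm i) (real_inner_self_pos.mpr hi)⟩

lemma eq_zero_of_massInner_self (hm : ∀ i, 0 < m i) {x : Config n} (hx : massInner m x x = 0) :
    x = 0 := by
  by_contra h
  exact (massInner_self_pos hm h).ne' hx

lemma massInner_translation (m : Fin n → ℝ) (v : E4) (x : Config n) :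
    massInner m (WithLp.toLp 2 fun _ => v) x = ⟪v, ∑ i, m i • x i⟫_ℝ := by
  simp [massInner_apply, inner_smul_right, inner_sum]

lemma massInner_blockDiag_of_isSymmetric (m : Fin n → ℝ) {A : E4 →ₗ[ℝ] E4} (hA : A.IsSymmetric)
    (x y : Config n) : massInner m (blockDiag n A x) y = massInner m x (blockDiag n A y) := by
  simp only [massInner_apply, blockDiag_apply, hA _ _]

end Mass

section Potential

variable {n : ℕ} {m : Fin n → ℝ} {q : Config n}

lemma IsCentralConfiguration.ne_zero (hq : IsCentralConfiguration m q) : q ≠ 0 := by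
  rintro rfl
  simpa using hq.normalized

lemma IsCentralConfiguration.one_lt (hm : ∀ i, 0 < m i) (hq : IsCentralConfiguration m q) :
    1 < n := by
  by_contra! hn
  have : Subsingleton (Fin n) := Fin.subsingleton_iff_le_one.mpr hn
  refine hq.ne_zero (PiLp.ext fun i => ?_)
  have h := hq.centered
  rw [Fintype.sum_subsingleton _ i] at h
  exact (smul_eq_zero.mp h).resolve_left (hm i).ne'

lemma potential_pos (hm : ∀ i, 0 < m i) (hq : IsCentralConfiguration m q) :
    0 < potential m q := by
  have hn := hq.one_lt hm
  have h : ∀ i j, 0 ≤ m i * m j / ‖q i - q j‖ := fun i j =>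
    div_nonneg (mul_pos (hm i) (hm j)).le (norm_nonneg _)
  have hlt : (⟨1, hn⟩ : Fin n) ∈ Finset.Ioi ⟨0, by omega⟩ :=
    Finset.mem_Ioi.mpr Nat.zero_lt_one
  refine Finset.sum_pos' (fun i _ => Finset.sum_nonneg fun j _ => h i j)
    ⟨_, Finset.mem_univ _, Finset.sum_pos' (fun j _ => h _ j) ⟨_, hlt, ?_⟩⟩
  exact div_pos (mul_pos (hm _) (hm _))
    (norm_pos_iff.mpr (sub_ne_zero_of_mem_Ioi hq.collisionFree hlt))

lemma angularSpeed_sq (hm : ∀ i, 0 < m i) (hq : IsCentralConfiguration m q) :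
    angularSpeed m q ^ 2 = potential m q := by
  unfold angularSpeed
  rw [hq.normalized, div_one, Real.sq_sqrt (potential_pos hm hq).le]

lemma angularSpeed_ne_zero (hm : ∀ i, 0 < m i) (hq : IsCentralConfiguration m q) :
    angularSpeed m q ≠ 0 := fun h => by
  simpa [h, (potential_pos hm hq).ne] using angularSpeed_sq hm hq

/-- The second derivative at `a`, in the directions `b` and `c`, of the Kepler potential
`1 / ‖a‖`. -/
def keplerHessian (a b c : E4) : ℝ :=
  -(⟪b, c⟫_ℝ / ‖a‖ ^ 3 - 3 * ⟪a, b⟫_ℝ * ⟪a, c⟫_ℝ / ‖a‖ ^ 5)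

lemma keplerHessian_of_inner_eq_zero {a b : E4} (hab : ⟪a, b⟫_ℝ = 0) (c : E4) :
    keplerHessian a b c = -(⟪b, c⟫_ℝ / ‖a‖ ^ 3) := by
  simp [keplerHessian, hab]

lemma keplerHessian_map (σ : E4 →ₗᵢ[ℝ] E4) (a b c : E4) :
    keplerHessian (σ a) (σ b) (σ c) = keplerHessian a b c := by
  simp [keplerHessian]

lemma hasDerivAt_inner_div_norm_cube {a : E4} (ha : a ≠ 0) (b c : E4) :
    HasDerivAt (fun t : ℝ => -(⟪a + t • b, c⟫_ℝ / ‖a + t • b‖ ^ 3)) (keplerHessian a b c) 0 := by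
  have hnorm : ‖a‖ ≠ 0 := norm_ne_zero_iff.mpr ha
  have hcube := (hasDerivAt_div_norm 1 ha b).pow 3
  have hinner : HasDerivAt (fun t : ℝ => ⟪a + t • b, c⟫_ℝ) ⟪b, c⟫_ℝ 0 := by
    simpa [inner_add_left, inner_smul_left] using
      ((hasDerivAt_id (0 : ℝ)).mul_const ⟪b, c⟫_ℝ).const_add ⟪a, c⟫_ℝ
  refine ((hinner.mul hcube).neg.congr_deriv ?_).congr_of_eventuallyEq (.of_forall fun t => ?_)
  · simp only [keplerHessian, zero_smul, add_zero, Pi.pow_apply, Nat.reduceSub]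
    field_simp
    push_cast
    ring
  · simp [div_eq_mul_inv]

lemma hasDerivAt_fderiv_potential (m : Fin n → ℝ) {x : Config n}
    (hx : ∀ i j, i ≠ j → x i ≠ x j) (v w : Config n) :
    HasDerivAt (fun t : ℝ => fderiv ℝ (potential m) (x + t • v) w)
      (∑ i, ∑ j ∈ Finset.Ioi i,
        m i * m j * keplerHessian (x i - x j) (v i - v j) (w i - w j)) 0 := by
  have hcont : ContinuousAt (fun t : ℝ => x + t • v) 0 := by fun_prop
  have hev := hcont.eventually_mem (isOpen_collisionFree.mem_nhds (by simpa using hx))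
  refine HasDerivAt.congr_of_eventuallyEq
    (HasDerivAt.fun_sum fun i _ => HasDerivAt.fun_sum fun j hj =>
      (hasDerivAt_inner_div_norm_cube (sub_ne_zero_of_mem_Ioi hx hj) _ _).const_mul _) ?_
  filter_upwards [hev] with t ht
  rw [fderiv_potential m ht]
  refine Finset.sum_congr rfl fun i _ => Finset.sum_congr rfl fun j _ => ?_
  have hsub : (x + t • v) i - (x + t • v) j = x i - x j + t • (v i - v j) := by
    simp only [PiLp.add_apply, PiLp.smul_apply, smul_sub]
    abel
  rw [hsub, mul_div_assoc, mul_neg]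

lemma inner_hessU (m : Fin n → ℝ) {x : Config n} (hx : ∀ i j, i ≠ j → x i ≠ x j)
    (v w : Config n) : ⟪hessU m x v, w⟫_ℝ = ∑ i, ∑ j ∈ Finset.Ioi i,
      m i * m j * keplerHessian (x i - x j) (v i - v j) (w i - w j) := by
  have hU := contDiffAt_potential m hx
  have hdiff := (hU.fderiv_right (m := 1) (by norm_num)).differentiableAt (by norm_num)
  have hline := (hdiff.hasFDerivAt.clm_apply (hasFDerivAt_const w x)).hasLineDerivAt v
  refine (inner_fderiv_gradient hU v w).trans
    (HasDerivAt.unique ?_ (hasDerivAt_fderiv_potential m hx v w))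
  simpa [HasLineDerivAt] using hline

end Potential

section Splitting

variable {n : ℕ} {m : Fin n → ℝ} {q : Config n}

lemma orthogonal_sup {R M : Type*} [CommRing R] [AddCommGroup M] [Module R M]
    (B : LinearMap.BilinForm R M) (S T : Submodule R M) :
    B.orthogonal (S ⊔ T) = B.orthogonal S ⊓ B.orthogonal T := by
  refine le_antisymm (le_inf (LinearMap.BilinForm.orthogonal_le le_sup_left)
    (LinearMap.BilinForm.orthogonal_le le_sup_right)) ?_
  rintro x ⟨hS, hT⟩ _ hst
  obtain ⟨s, hs, t, ht, rfl⟩ := Submodule.mem_sup.mp hst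
  have h : B s x + B t x = 0 := by rw [hS s hs, hT t ht, add_zero]
  simpa using h

lemma finrank_sup_of_disjoint {K E : Type*} [Field K] [AddCommGroup E] [Module K E]
    [FiniteDimensional K E] {S T : Submodule K E} (h : Disjoint S T) :
    Module.finrank K ↥(S ⊔ T) = Module.finrank K S + Module.finrank K T := by
  rw [← Submodule.finrank_sup_add_finrank_inf_eq, h.eq_bot, finrank_bot, add_zero]

lemma disjoint_of_le_massInner_orthogonal (hm : ∀ i, 0 < m i) {S T : Submodule ℝ (Config n)}
    (h : T ≤ (massInner m).orthogonal S) : Disjoint S T :=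
  Submodule.disjoint_def.mpr fun x hS hT => eq_zero_of_massInner_self hm (h hT x hS)

lemma isCompl_massInner_orthogonal (hm : ∀ i, 0 < m i) (S : Submodule ℝ (Config n)) :
    IsCompl S ((massInner m).orthogonal S) :=
  (LinearMap.BilinForm.isCompl_orthogonal_iff_disjoint (massInner_isSymm m).isRefl).mpr
    (disjoint_of_le_massInner_orthogonal hm le_rfl)

lemma finrank_config : Module.finrank ℝ (Config n) = 4 * n := by
  rw [(WithLp.linearEquiv 2 ℝ (Fin n → E4)).finrank_eq, Module.finrank_pi_fintype]
  simp [mul_comm]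

lemma mem_translations (v : E4) : (WithLp.toLp 2 fun _ => v : Config n) ∈ translations n :=
  Submodule.subset_span ⟨v, rfl⟩

lemma finrank_translations [NeZero n] : Module.finrank ℝ (translations n) = 4 := by
  let diagonal : E4 →ₗ[ℝ] Config n :=
    { toFun v := WithLp.toLp 2 fun _ => v
      map_add' _ _ := rfl
      map_smul' _ _ := rfl }
  have hinj : Function.Injective diagonal := fun v w h => congrArg (fun y : Config n => y 0) h
  have hrange : translations n = LinearMap.range diagonal := by
    refine le_antisymm (fun x hx => ?_) ?_
    · obtain ⟨v, rfl⟩ := translations_eq hx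
      exact ⟨v, rfl⟩
    · rintro _ ⟨v, rfl⟩
      exact mem_translations v
  rw [hrange, LinearMap.finrank_range_of_inj hinj, finrank_euclideanSpace_fin]

lemma massInner_orthogonal_translations {x : Config n} :
    x ∈ (massInner m).orthogonal (translations n) ↔ ∑ i, m i • x i = 0 := by
  refine ⟨fun h => ext_inner_left ℝ fun v => ?_, fun h t ht => ?_⟩
  · rw [← massInner_translation, inner_zero_right]
    exact h _ (mem_translations v)
  · obtain ⟨v, rfl⟩ := translations_eq ht
    rw [massInner_translation, h, inner_zero_right]

lemma tangentEllipsoid_eq_orthogonal (m : Fin n → ℝ) (q : Config n) :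
    tangentEllipsoid m q =
      (massInner m).orthogonal (translations n ⊔ Submodule.span ℝ {q}) := by
  ext x
  rw [orthogonal_sup, Submodule.mem_inf, massInner_orthogonal_translations]
  refine and_congr_right fun _ =>
    ⟨fun h s hs => ?_, fun h => h q (Submodule.mem_span_singleton_self q)⟩
  obtain ⟨c, rfl⟩ := Submodule.mem_span_singleton.mp hs
  rw [map_smul, LinearMap.smul_apply]
  exact (congrArg (c • ·) h).trans (smul_zero c)

lemma orbitTangent_le_tangentEllipsoid (hq : IsCentralConfiguration m q) :
    orbitTangent q ≤ tangentEllipsoid m q := by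
  intro z hz
  obtain ⟨a, ha, rfl⟩ := orbitTangent_eq hz
  refine ⟨?_, ?_⟩
  · simp only [blockDiag_apply, ← map_smul, ← map_sum, hq.centered, map_zero]
  · change massInner m q _ = 0
    simp [massInner_apply, blockDiag_apply, ha.inner_self]

lemma finrank_tangentEllipsoid_add (hm : ∀ i, 0 < m i) (hq : IsCentralConfiguration m q) :
    Module.finrank ℝ (tangentEllipsoid m q) + 5 = 4 * n := by
  have : NeZero n := ⟨(zero_lt_one.trans (hq.one_lt hm)).ne'⟩
  have hd : Disjoint (translations n) (Submodule.span ℝ {q}) :=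
    disjoint_of_le_massInner_orthogonal hm <| (Submodule.span_singleton_le_iff_mem _ _).mpr <|
      massInner_orthogonal_translations.mpr hq.centered
  have h := Submodule.finrank_add_eq_of_isCompl
    (isCompl_massInner_orthogonal hm (translations n ⊔ Submodule.span ℝ {q}))
  rw [← tangentEllipsoid_eq_orthogonal, finrank_sup_of_disjoint hd, finrank_translations,
    finrank_span_singleton hq.ne_zero, finrank_config] at h
  omega

end Splitting

section Rotations

variable {n : ℕ} {m : Fin n → ℝ} {q : Config n}

lemma quatI_mul_quatI : quatI * quatI = -1 := by
  ext i j
  fin_cases i <;> fin_cases j <;> simp [quatI, Matrix.mul_apply, Fin.sum_univ_four]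

lemma quatJ_mul_quatJ : quatJ * quatJ = -1 := by
  ext i j
  fin_cases i <;> fin_cases j <;> simp [quatJ, Matrix.mul_apply, Fin.sum_univ_four]

lemma quatK_mul_quatK : quatK * quatK = -1 := by
  ext i j
  fin_cases i <;> fin_cases j <;> simp [quatK, Matrix.mul_apply, Fin.sum_univ_four]

lemma quatJ_mul_quatK : quatJ * quatK = quatI := by
  ext i j
  fin_cases i <;> fin_cases j <;>
    simp [quatI, quatJ, quatK, Matrix.mul_apply, Fin.sum_univ_four]

lemma quatK_mul_quatI : quatK * quatI = quatJ := by
  ext i j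
  fin_cases i <;> fin_cases j <;>
    simp [quatI, quatJ, quatK, Matrix.mul_apply, Fin.sum_univ_four]

lemma inner_blockDiag_self_of_isSkew {a : E4 →ₗ[ℝ] E4} (ha : IsSkew a) (x : Config n) :
    ⟪x, blockDiag n a x⟫_ℝ = 0 := by
  simp [inner_config, blockDiag_apply, ha.inner_self]

lemma inner_blockDiag_act_of_mul_eq {A B C : Matrix (Fin 4) (Fin 4) ℝ} (hA : IsSkew (act A))
    (hC : IsSkew (act C)) (h : A * B = C) (x : Config n) :
    ⟪blockDiag n (act A) x, blockDiag n (act B) x⟫_ℝ = 0 := by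
  have h0 := inner_blockDiag_self_of_isSkew hC x
  rw [inner_config] at h0 ⊢
  simp only [blockDiag_apply, ← h, act_mul] at h0 ⊢
  simp only [hA _ _, Finset.sum_neg_distrib, h0, neg_zero]

lemma blockDiag_ne_zero {a : E4 →ₗ[ℝ] E4} (ha : Function.Injective a) {x : Config n}
    (hx : x ≠ 0) : blockDiag n a x ≠ 0 := fun h =>
  hx (PiLp.ext fun i => ha ((congrArg (fun y : Config n => y i) h).trans (map_zero a).symm))

lemma act_injective_of_sq_eq_neg_one {A : Matrix (Fin 4) (Fin 4) ℝ} (h : A * A = -1) :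
    Function.Injective (act A) := fun x y hxy => by
  have := congrArg (act A) hxy
  simpa [← act_mul, h, act] using this

lemma finrank_span_quaternion (hq : q ≠ 0) :
    Module.finrank ℝ (Submodule.span ℝ {blockDiag n (act quatI) q, blockDiag n (act quatJ) q,
      blockDiag n (act quatK) q}) = 3 := by
  have hIJ := inner_blockDiag_act_of_mul_eq quatI_skew quatK_skew quatI_mul_quatJ q
  have hJK := inner_blockDiag_act_of_mul_eq quatJ_skew quatI_skew quatJ_mul_quatK q
  have hKI := inner_blockDiag_act_of_mul_eq quatK_skew quatJ_skew quatK_mul_quatI q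
  have hne : ∀ A : Matrix (Fin 4) (Fin 4) ℝ, A * A = -1 → blockDiag n (act A) q ≠ 0 :=
    fun A hA => blockDiag_ne_zero (act_injective_of_sq_eq_neg_one hA) hq
  have hli : LinearIndependent ℝ ![blockDiag n (act quatI) q, blockDiag n (act quatJ) q,
      blockDiag n (act quatK) q] := by
    refine linearIndependent_of_ne_zero_of_inner_eq_zero (𝕜 := ℝ) (fun i => ?_) fun i j hij => ?_
    · fin_cases i
      exacts [hne _ quatI_mul_quatI, hne _ quatJ_mul_quatJ, hne _ quatK_mul_quatK]
    · fin_cases i <;> fin_cases j <;> simp_all [real_inner_comm]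
  have h := finrank_span_eq_card hli
  rwa [Matrix.range_cons, Matrix.range_cons_cons_empty, Set.singleton_union, Fintype.card_fin] at h

/-- The infinitesimal rotations of `q` among `rotationDirections`; together with `q` they span
the latter. -/
def frameRotations (m : Fin n → ℝ) (q : Config n) : Submodule ℝ (Config n) :=
  open Classical in
  if IsPlanarRE m q then orbitTangent q
  else Submodule.span ℝ {blockDiag n (act quatI) q, blockDiag n (act quatJ) q,
    blockDiag n (act quatK) q}

lemma rotationDirections_eq_sup (m : Fin n → ℝ) (q : Config n) :
    rotationDirections m q = Submodule.span ℝ {q} ⊔ frameRotations m q := by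
  unfold rotationDirections frameRotations
  split_ifs
  · rfl
  · exact Submodule.span_insert _ _

lemma frameRotations_le_orbitTangent (m : Fin n → ℝ) (q : Config n) :
    frameRotations m q ≤ orbitTangent q := by
  unfold frameRotations
  split_ifs
  · exact le_rfl
  · rw [Submodule.span_le]
    rintro _ (rfl | rfl | rfl)
    exacts [blockDiag_mem_orbitTangent q quatI_skew, blockDiag_mem_orbitTangent q quatJ_skew,
      blockDiag_mem_orbitTangent q quatK_skew]

lemma IsPlanarRE.isPlanar (h : IsPlanarRE m q) : IsPlanar q :=
  (Submodule.finrank_mono (Submodule.span_le.mpr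
    (Set.range_subset_iff.mpr (mem_motionSpan m q)))).trans h

lemma finrank_frameRotations_add_one (hq : q ≠ 0) :
    Module.finrank ℝ (frameRotations m q) + 1 = blockSize m q := by
  unfold frameRotations blockSize
  by_cases hRE : IsPlanarRE m q
  · rw [if_pos hRE]
    by_cases hcol : IsCollinear q
    · simp [hcol, finrank_orbitTangent_of_collinear hq hcol]
    · simp [hRE, hcol, finrank_orbitTangent_of_planar hRE.isPlanar hcol]
  · rw [if_neg hRE, finrank_span_quaternion hq]
    simp [hRE]

end Rotations

section Reduction

variable {n : ℕ} {m : Fin n → ℝ} {q : Config n}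

lemma massInner_frameK (m : Fin n → ℝ) (q x y : Config n) :
    massInner m (frameK m q x) y = -massInner m x (frameK m q y) := by
  change ⟪massMatrix m (frameK m q x), y⟫_ℝ = _
  rw [show massMatrix m (frameK m q x) = frameK m q (massMatrix m x) from
    massMatrix_blockDiag m _ x, inner_frameK]
  rfl

/-- The subspace `ℝ⁴ + V` of configurations whose copies in positions and momenta make up
`E₁ ⊕ E₂`. -/
def splitOff (m : Fin n → ℝ) (q : Config n) : Submodule ℝ (Config n) :=
  translations n ⊔ rotationDirections m q

/-- The mass-orthogonal complement of `splitOff`, which carries the dynamics of `JB₃`. -/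
def reduced (m : Fin n → ℝ) (q : Config n) : Submodule ℝ (Config n) :=
  (massInner m).orthogonal (splitOff m q)

lemma reduced_eq_inf (m : Fin n → ℝ) (q : Config n) :
    reduced m q = (massInner m).orthogonal (frameRotations m q) ⊓ tangentEllipsoid m q := by
  rw [reduced, splitOff, rotationDirections_eq_sup, ← sup_assoc, orthogonal_sup,
    tangentEllipsoid_eq_orthogonal, inf_comm]

lemma disjoint_frameRotations_reduced (hm : ∀ i, 0 < m i) (q : Config n) :
    Disjoint (frameRotations m q) (reduced m q) :=
  disjoint_of_le_massInner_orthogonal hm ((reduced_eq_inf m q).trans_le inf_le_left)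

lemma frameRotations_sup_reduced (hm : ∀ i, 0 < m i) (hq : IsCentralConfiguration m q) :
    frameRotations m q ⊔ reduced m q = tangentEllipsoid m q := by
  rw [reduced_eq_inf, ← sup_inf_assoc_of_le _
    ((frameRotations_le_orbitTangent m q).trans (orbitTangent_le_tangentEllipsoid hq)),
    (isCompl_massInner_orthogonal hm _).sup_eq_top, top_inf_eq]

lemma finrank_reduced (hm : ∀ i, 0 < m i) (hq : IsCentralConfiguration m q) :
    4 + blockSize m q + Module.finrank ℝ (reduced m q) = 4 * n := by
  have h := finrank_sup_of_disjoint (disjoint_frameRotations_reduced hm q)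
  rw [frameRotations_sup_reduced hm hq] at h
  have := finrank_tangentEllipsoid_add hm hq
  have := finrank_frameRotations_add_one (m := m) hq.ne_zero
  omega

lemma polar_quadForm {A : Config n →ₗ[ℝ] Config n} (hA : A.IsSymmetric) (x y : Config n) :
    QuadraticMap.polar (quadForm A) x y = 2 * ⟪A x, y⟫_ℝ := by
  change QuadraticMap.polar (LinearMap.BilinMap.toQuadraticMap _) x y = _
  rw [LinearMap.BilinMap.polar_toQuadraticMap]
  change ⟪A x, y⟫_ℝ + ⟪A y, x⟫_ℝ = _
  rw [hA y x, real_inner_comm (A x), two_mul]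

/-- The quadratic form of `D²U(q) + U(q) M`, whose restriction to the tangent space of the inertia
ellipsoid is `hessian`. -/
def hessForm (m : Fin n → ℝ) (q : Config n) : QuadraticForm ℝ (Config n) :=
  quadForm (hessU m q + potential m q • massMatrix m)

lemma inner_hessU_add_smul (m : Fin n → ℝ) (q x y : Config n) :
    ⟪(hessU m q + potential m q • massMatrix m) x, y⟫_ℝ =
      ⟪hessU m q x, y⟫_ℝ + potential m q * massInner m x y := by
  rw [LinearMap.add_apply, inner_add_left, LinearMap.smul_apply, real_inner_smul_left]
  rfl

lemma hessForm_apply (m : Fin n → ℝ) (q x : Config n) :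
    hessForm m q x = ⟪hessU m q x, x⟫_ℝ + potential m q * massInner m x x :=
  inner_hessU_add_smul m q x x

lemma polar_hessForm (hq : IsCentralConfiguration m q) (x y : Config n) :
    QuadraticMap.polar (hessForm m q) x y =
      2 * (⟪hessU m q x, y⟫_ℝ + potential m q * massInner m x y) := by
  rw [hessForm, polar_quadForm, inner_hessU_add_smul]
  intro x y
  refine Eq.trans ?_ (real_inner_comm _ _)
  rw [inner_hessU_add_smul, inner_hessU_add_smul, hessU_symm m hq.collisionFree, real_inner_comm,
    (massInner_isSymm m).eq x]

lemma polar_hessForm_of_mem_orbitTangent (hq : IsCentralConfiguration m q) {x : Config n}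
    (hx : x ∈ orbitTangent q) (y : Config n) : QuadraticMap.polar (hessForm m q) x y = 0 := by
  obtain ⟨a, ha, rfl⟩ := orbitTangent_eq hx
  rw [polar_hessForm hq, hessU_skew hq ha, real_inner_smul_left]
  change 2 * (-potential m q * massInner m _ y + _) = 0
  ring

lemma hessian_equivalent_prod (hm : ∀ i, 0 < m i) (hq : IsCentralConfiguration m q) :
    (((hessForm m q).restrict (frameRotations m q)).prod
      ((hessForm m q).restrict (reduced m q))).Equivalent (hessian m q) := by
  have h := equivalent_restrict_sup (disjoint_frameRotations_reduced hm q) fun x hx y _ =>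
    polar_hessForm_of_mem_orbitTangent hq (frameRotations_le_orbitTangent m q hx) y
  rwa [frameRotations_sup_reduced hm hq] at h

lemma radical_hessForm_restrict_frameRotations (hq : IsCentralConfiguration m q) :
    ((hessForm m q).restrict (frameRotations m q)).radical = ⊤ :=
  Submodule.eq_top_iff'.mpr fun x => mem_radical_iff_polar.mpr fun y =>
    polar_hessForm_of_mem_orbitTangent hq (frameRotations_le_orbitTangent m q x.2) y

lemma morseIndex_eq_sigNeg (hm : ∀ i, 0 < m i) (hq : IsCentralConfiguration m q) :
    morseIndex m q = sigNeg ((hessForm m q).restrict (reduced m q)) := by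
  have h := QuadraticForm.sigPos_add_sigNeg_add_radical
    (Q := (hessForm m q).restrict (frameRotations m q))
  rw [radical_hessForm_restrict_frameRotations hq, finrank_top] at h
  rw [morseIndex, ← (hessian_equivalent_prod hm hq).sigNeg_eq, sigNeg_prod]
  omega

lemma nullity_add_one (hm : ∀ i, 0 < m i) (hq : IsCentralConfiguration m q) :
    nullity m q + 1 = blockSize m q +
      Module.finrank ℝ ((hessForm m q).restrict (reduced m q)).radical := by
  rw [nullity, ← (hessian_equivalent_prod hm hq).rank_radical_eq, finrank_radical_prod,
    radical_hessForm_restrict_frameRotations hq, finrank_top,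
    ← finrank_frameRotations_add_one (m := m) hq.ne_zero]
  ring

/-- The Hessian form `-⟨D²U(q) x, x⟩ - ⟨MKx, Kx⟩` of the effective potential in the rotating
frame. -/
def effForm (m : Fin n → ℝ) (q : Config n) : QuadraticForm ℝ (Config n) :=
  quadForm (-hessU m q + frameK m q ∘ₗ massMatrix m ∘ₗ frameK m q)

lemma inner_neg_hessU_add_comp (m : Fin n → ℝ) (q x y : Config n) :
    ⟪(-hessU m q + frameK m q ∘ₗ massMatrix m ∘ₗ frameK m q) x, y⟫_ℝ =
      -(⟪hessU m q x, y⟫_ℝ + massInner m (frameK m q x) (frameK m q y)) := by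
  rw [LinearMap.add_apply, inner_add_left, LinearMap.neg_apply, inner_neg_left, neg_add,
    LinearMap.comp_apply, LinearMap.comp_apply, inner_frameK]
  rfl

lemma effForm_apply (m : Fin n → ℝ) (q x : Config n) : effForm m q x =
    -(⟪hessU m q x, x⟫_ℝ + massInner m (frameK m q x) (frameK m q x)) :=
  inner_neg_hessU_add_comp m q x x

lemma polar_effForm (hq : IsCentralConfiguration m q) (x y : Config n) :
    QuadraticMap.polar (effForm m q) x y =
      -(2 * (⟪hessU m q x, y⟫_ℝ + massInner m (frameK m q x) (frameK m q y))) := by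
  rw [effForm, polar_quadForm, inner_neg_hessU_add_comp, mul_neg]
  intro x y
  refine Eq.trans ?_ (real_inner_comm _ _)
  rw [inner_neg_hessU_add_comp, inner_neg_hessU_add_comp, hessU_symm m hq.collisionFree,
    real_inner_comm, (massInner_isSymm m).eq (frameK m q x)]

end Reduction

section CompletingTheSquare

variable {n : ℕ} {m : Fin n → ℝ} {q : Config n}

lemma E₁_sup_E₂ (m : Fin n → ℝ) (q : Config n) :
    E₁ m ⊔ E₂ m q = (splitOff m q).prod ((splitOff m q).map (massMatrix m)) := by
  rw [E₁, E₂, Submodule.prod_sup_prod, ← Submodule.map_sup, splitOff]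

lemma mk_massMatrix_mem_E₃ {x y : Config n} :
    (x, massMatrix m y) ∈ E₃ m q ↔ x ∈ reduced m q ∧ y ∈ reduced m q := by
  have hω : ∀ s t : Config n,
      sympForm n (s, massMatrix m t) (x, massMatrix m y) = massInner m s y - massInner m t x := by
    intro s t
    rw [sympForm_apply, ← inner_massMatrix]
    change -massInner m t x + massInner m s y = _
    ring
  rw [E₃, E₁_sup_E₂]
  refine ⟨fun h => ⟨fun t ht => ?_, fun s hs => ?_⟩, ?_⟩
  · have := h (0, massMatrix m t) ⟨zero_mem _, Submodule.mem_map_of_mem ht⟩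
    rw [hω] at this
    simpa using this
  · have := h (s, massMatrix m 0) ⟨hs, Submodule.mem_map_of_mem (zero_mem _)⟩
    rw [hω] at this
    simpa using this
  · rintro ⟨hx, hy⟩ ⟨s, _⟩ ⟨hs, t, ht, rfl⟩
    rw [hω, hx t ht, hy s hs, sub_zero]

lemma frameK_mem_reduced {x : Config n} (hx : x ∈ reduced m q) : frameK m q x ∈ reduced m q := by
  intro w hw
  have hKw : frameK m q w ∈ splitOff m q := by
    obtain ⟨t, ht, v, hv, rfl⟩ := Submodule.mem_sup.mp hw
    rw [map_add]
    exact Submodule.add_mem_sup (frameK_translations m q ht) (frameK_rotationDirections m q hv)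
  rw [← neg_eq_zero, ← massInner_frameK, hx _ hKw]

/-- The coordinates `(x, y) ↦ (x, M(y - Kx))` on `E₃` in which the quadratic form of `B` splits:
`y` is the velocity in the rotating frame. -/
def completeSquare (m : Fin n → ℝ) (q : Config n) : reduced m q × reduced m q →ₗ[ℝ] Phase n :=
  ((reduced m q).subtype ∘ₗ LinearMap.fst ℝ _ _).prod
    (massMatrix m ∘ₗ ((reduced m q).subtype ∘ₗ LinearMap.snd ℝ _ _ -
      frameK m q ∘ₗ (reduced m q).subtype ∘ₗ LinearMap.fst ℝ _ _))

lemma completeSquare_apply (z : reduced m q × reduced m q) :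
    completeSquare m q z = (↑z.1, massMatrix m (↑z.2 - frameK m q z.1)) := rfl

lemma completeSquare_injective (hm : ∀ i, 0 < m i) (q : Config n) :
    Function.Injective (completeSquare m q) := by
  rintro ⟨x, y⟩ ⟨x', y'⟩ h
  obtain rfl : x = x' := Subtype.ext (congrArg Prod.fst h)
  have hy := massMatrix_injective hm (congrArg Prod.snd h)
  exact congrArg (Prod.mk x) (Subtype.ext (sub_left_injective hy))

lemma range_completeSquare (hm : ∀ i, 0 < m i) (q : Config n) :
    LinearMap.range (completeSquare m q) = E₃ m q := by
  refine le_antisymm ?_ fun z hz => ?_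
  · rintro _ ⟨z, rfl⟩
    exact mk_massMatrix_mem_E₃.mpr ⟨z.1.2, sub_mem z.2.2 (frameK_mem_reduced z.1.2)⟩
  · obtain ⟨x, p⟩ := z
    rw [← massMatrix_massMatrixInv hm p] at hz ⊢
    obtain ⟨hx, hp⟩ := mk_massMatrix_mem_E₃.mp hz
    refine ⟨(⟨x, hx⟩, ⟨_, add_mem hp (frameK_mem_reduced hx)⟩), ?_⟩
    rw [completeSquare_apply, add_sub_cancel_right]

lemma finrank_E₃ (hm : ∀ i, 0 < m i) (hq : IsCentralConfiguration m q) :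
    Module.finrank ℝ (E₃ m q) = 8 * n - 8 - 2 * blockSize m q := by
  rw [← range_completeSquare hm, LinearMap.finrank_range_of_inj (completeSquare_injective hm q),
    Module.finrank_prod]
  have := finrank_reduced hm hq
  omega

lemma phaseInner_matB_self (hm : ∀ i, 0 < m i) (q x y : Config n) :
    phaseInner n (matB m q (x, massMatrix m (y - frameK m q x)))
        (x, massMatrix m (y - frameK m q x)) =
      effForm m q x + massInner m y y := by
  have hp : ∀ w, ⟪massMatrix m (y - frameK m q x), w⟫_ℝ =
      massInner m y w - massInner m (frameK m q x) w := fun w =>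
    LinearMap.congr_fun (map_sub (massInner m) _ _) w
  rw [matB_apply, massMatrixInv_massMatrix hm, add_sub_cancel]
  change ⟪-hessU m q x - frameK m q (massMatrix m _), x⟫_ℝ + ⟪y, massMatrix m _⟫_ℝ = _
  rw [inner_sub_left, inner_frameK, real_inner_comm (massMatrix m _) y, hp, hp, inner_neg_left,
    effForm_apply, (massInner_isSymm m).eq y]
  ring

lemma formB₃_equivalent_prod (hm : ∀ i, 0 < m i) (q : Config n) :
    (((effForm m q).restrict (reduced m q)).prod
      ((massInner m).toQuadraticMap.restrict (reduced m q))).Equivalent (formB₃ m q) := by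
  have h := equivalent_restrict_range (completeSquare_injective hm q)
    (Q' := LinearMap.BilinMap.toQuadraticMap ((phaseInner n).comp (matB m q) LinearMap.id))
    (Q := ((effForm m q).restrict (reduced m q)).prod
      ((massInner m).toQuadraticMap.restrict (reduced m q)))
    fun z => phaseInner_matB_self hm q z.1 z.2
  rwa [range_completeSquare hm] at h

lemma posDef_massInner_restrict (hm : ∀ i, 0 < m i) (S : Submodule ℝ (Config n)) :
    ((massInner m).toQuadraticMap.restrict S).PosDef := fun _ hx =>
  massInner_self_pos hm (Subtype.coe_ne_coe.mpr hx)

lemma sigNeg_formB₃ (hm : ∀ i, 0 < m i) (q : Config n) :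
    sigNeg (formB₃ m q) = sigNeg ((effForm m q).restrict (reduced m q)) := by
  rw [← (formB₃_equivalent_prod hm q).sigNeg_eq, sigNeg_prod,
    sigNeg_eq_zero_of_posDef (posDef_massInner_restrict hm _), add_zero]

lemma finrank_radical_formB₃ (hm : ∀ i, 0 < m i) (q : Config n) :
    Module.finrank ℝ (formB₃ m q).radical =
      Module.finrank ℝ ((effForm m q).restrict (reduced m q)).radical := by
  rw [← (formB₃_equivalent_prod hm q).rank_radical_eq, finrank_radical_prod,
    finrank_radical_eq_zero_of_posDef (posDef_massInner_restrict hm _), add_zero]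

end CompletingTheSquare

section ReducedIn

variable {n : ℕ} {m : Fin n → ℝ} {q : Config n}

lemma blockDiag_mem_splitOff (hRE : IsPlanarRE m q) {A : E4 →ₗ[ℝ] E4} (hA : A.IsSymmetric)
    (hAq : ∀ i, A (q i) = q i) {x : Config n} (hx : x ∈ splitOff m q) :
    blockDiag n A x ∈ splitOff m q := by
  have hrot : rotationDirections m q = Submodule.span ℝ {q} ⊔ orbitTangent q := if_pos hRE
  rw [splitOff, hrot] at hx ⊢
  obtain ⟨t, ht, _, hs, rfl⟩ := Submodule.mem_sup.mp hx
  obtain ⟨y, hy, z, hz, rfl⟩ := Submodule.mem_sup.mp hs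
  obtain ⟨v, rfl⟩ := translations_eq ht
  obtain ⟨c, rfl⟩ := Submodule.mem_span_singleton.mp hy
  obtain ⟨a, ha, rfl⟩ := orbitTangent_eq hz
  have hAaA : IsSkew (A ∘ₗ a ∘ₗ A) := fun u w => by
    simp only [LinearMap.comp_apply]
    rw [hA, ha, ← hA]
  have hrotation : blockDiag n A (blockDiag n a q) = blockDiag n (A ∘ₗ a ∘ₗ A) q := by
    ext1 i
    simp only [blockDiag_apply, LinearMap.comp_apply, hAq]
  have hself : blockDiag n A q = q := PiLp.ext hAq
  rw [map_add, map_add, map_smul, hrotation, hself]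
  exact Submodule.add_mem_sup (mem_translations (A v))
    (Submodule.add_mem_sup (Submodule.smul_mem _ c (Submodule.mem_span_singleton_self q))
      (blockDiag_mem_orbitTangent q hAaA))

lemma blockDiag_mem_reduced (hRE : IsPlanarRE m q) {A : E4 →ₗ[ℝ] E4} (hA : A.IsSymmetric)
    (hAq : ∀ i, A (q i) = q i) {x : Config n} (hx : x ∈ reduced m q) :
    blockDiag n A x ∈ reduced m q := fun w hw => by
  rw [← massInner_blockDiag_of_isSymmetric m hA, hx _ (blockDiag_mem_splitOff hRE hA hAq hw)]

/-- The reduced configurations all of whose bodies lie in `W`. -/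
def reducedIn (m : Fin n → ℝ) (q : Config n) (W : Submodule ℝ E4) : Submodule ℝ (Config n) :=
  reduced m q ⊓ ⨅ i, W.comap (PiLp.projₗ 2 (fun _ => E4) i)

lemma mem_reducedIn {W : Submodule ℝ E4} {x : Config n} :
    x ∈ reducedIn m q W ↔ x ∈ reduced m q ∧ ∀ i, x i ∈ W := by
  simp [reducedIn]

lemma reducedIn_top (m : Fin n → ℝ) (q : Config n) : reducedIn m q ⊤ = reduced m q := by
  simp [reducedIn]

lemma disjoint_reducedIn {V W : Submodule ℝ E4} (h : Disjoint V W) :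
    Disjoint (reducedIn m q V) (reducedIn m q W) :=
  Submodule.disjoint_def.mpr fun _ hV hW => PiLp.ext fun i =>
    Submodule.disjoint_def.mp h _ ((mem_reducedIn.mp hV).2 i) ((mem_reducedIn.mp hW).2 i)

lemma reducedIn_inf_sup_reducedIn_inf_orthogonal (hRE : IsPlanarRE m q) {V W : Submodule ℝ E4}
    (hqW : ∀ i, q i ∈ W) (hV : ∀ v ∈ V, W.starProjection v ∈ V) :
    reducedIn m q (V ⊓ W) ⊔ reducedIn m q (V ⊓ Wᗮ) = reducedIn m q V := by
  refine le_antisymm (sup_le ?_ ?_) fun x hx => ?_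
  · exact fun x hx => mem_reducedIn.mpr ((mem_reducedIn.mp hx).imp_right fun h i => (h i).1)
  · exact fun x hx => mem_reducedIn.mpr ((mem_reducedIn.mp hx).imp_right fun h i => (h i).1)
  · obtain ⟨hxr, hxV⟩ := mem_reducedIn.mp hx
    set y := blockDiag n (W.starProjection : E4 →ₗ[ℝ] E4) x
    have hy : y ∈ reduced m q := blockDiag_mem_reduced hRE W.starProjection_isSymmetric
      (fun i => Submodule.starProjection_eq_self_iff.mpr (hqW i)) hxr
    rw [← add_sub_cancel y x]
    exact Submodule.add_mem_sup
      (mem_reducedIn.mpr ⟨hy, fun i => ⟨hV _ (hxV i), W.starProjection_apply_mem _⟩⟩)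
      (mem_reducedIn.mpr ⟨sub_mem hxr hy, fun i =>
        ⟨sub_mem (hxV i) (hV _ (hxV i)), W.sub_starProjection_mem_orthogonal _⟩⟩)

end ReducedIn

section Orthogonality

variable {n : ℕ} {m : Fin n → ℝ} {q : Config n} {W : Submodule ℝ E4}

lemma inner_hessU_of_mem_orthogonal (hq : IsCentralConfiguration m q) (hqW : ∀ i, q i ∈ W)
    {x : Config n} (hx : ∀ i, x i ∈ Wᗮ) (y : Config n) : ⟪hessU m q x, y⟫_ℝ =
      -∑ i, ∑ j ∈ Finset.Ioi i, m i * m j * (⟪x i - x j, y i - y j⟫_ℝ / ‖q i - q j‖ ^ 3) := by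
  rw [inner_hessU m hq.collisionFree]
  have h : ∀ i j, ⟪q i - q j, x i - x j⟫_ℝ = 0 := fun i j =>
    sub_mem (hx i) (hx j) _ (sub_mem (hqW i) (hqW j))
  simp only [keplerHessian_of_inner_eq_zero (h _ _), mul_neg, Finset.sum_neg_distrib]

lemma inner_hessU_eq_zero (hq : IsCentralConfiguration m q) (hqW : ∀ i, q i ∈ W)
    {x y : Config n} (hx : ∀ i, x i ∈ Wᗮ) (hy : ∀ i, y i ∈ W) : ⟪hessU m q x, y⟫_ℝ = 0 := by
  have h : ∀ i j, ⟪x i - x j, y i - y j⟫_ℝ = 0 := fun i j =>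
    Submodule.inner_left_of_mem_orthogonal (sub_mem (hy i) (hy j)) (sub_mem (hx i) (hx j))
  rw [inner_hessU_of_mem_orthogonal hq hqW hx]
  simp [h]

lemma polar_hessForm_eq_zero (hq : IsCentralConfiguration m q) (hqW : ∀ i, q i ∈ W)
    {x y : Config n} (hx : ∀ i, x i ∈ W) (hy : ∀ i, y i ∈ Wᗮ) :
    QuadraticMap.polar (hessForm m q) x y = 0 := by
  have h : massInner m y x = 0 := by
    rw [massInner_apply]
    exact Finset.sum_eq_zero fun i _ => by
      rw [Submodule.inner_left_of_mem_orthogonal (hx i) (hy i), mul_zero]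
  rw [QuadraticMap.polar_comm, polar_hessForm hq, inner_hessU_eq_zero hq hqW hy hx, h]
  simp

lemma hessForm_restrict_equivalent_prod (hq : IsCentralConfiguration m q) (hRE : IsPlanarRE m q)
    {V : Submodule ℝ E4} (hqW : ∀ i, q i ∈ W) (hV : ∀ v ∈ V, W.starProjection v ∈ V) :
    (((hessForm m q).restrict (reducedIn m q (V ⊓ W))).prod
      ((hessForm m q).restrict (reducedIn m q (V ⊓ Wᗮ)))).Equivalent
      ((hessForm m q).restrict (reducedIn m q V)) := by
  rw [← reducedIn_inf_sup_reducedIn_inf_orthogonal hRE hqW hV]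
  refine equivalent_restrict_sup
    (disjoint_reducedIn (W.orthogonal_disjoint.mono inf_le_right inf_le_right)) fun x hx y hy =>
      polar_hessForm_eq_zero hq hqW (fun i => ((mem_reducedIn.mp hx).2 i).2)
        fun i => ((mem_reducedIn.mp hy).2 i).2

lemma hessForm_blockDiag_of_linearIsometry (hq : IsCentralConfiguration m q) (σ : E4 →ₗᵢ[ℝ] E4)
    (hσ : ∀ i, σ (q i) = q i) (x : Config n) :
    hessForm m q (blockDiag n σ.toLinearMap x) = hessForm m q x := by
  have hk : ∀ i j, keplerHessian (q i - q j) (σ (x i) - σ (x j)) (σ (x i) - σ (x j)) =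
      keplerHessian (q i - q j) (x i - x j) (x i - x j) := fun i j => by
    simpa only [map_sub, hσ] using
      keplerHessian_map σ (q i - q j) (x i - x j) (x i - x j)
  simp [hessForm_apply, inner_hessU m hq.collisionFree, massInner_apply, blockDiag_apply, hk]

end Orthogonality

section EffectivePotential

variable {n : ℕ} {m : Fin n → ℝ} {q : Config n}

lemma frameGenerator_of_not_isPlanarRE (hRE : ¬ IsPlanarRE m q) (v : E4) :
    frameGenerator m q v = angularSpeed m q • act quatI v := by
  rw [frameGenerator, if_neg hRE, LinearMap.smul_apply]

lemma frameGenerator_of_mem_motionSpan (hRE : IsPlanarRE m q) {v : E4}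
    (hv : v ∈ motionSpan m q) : frameGenerator m q v = angularSpeed m q • act quatI v := by
  rw [frameGenerator, if_pos hRE, LinearMap.smul_apply, LinearMap.comp_apply,
    ContinuousLinearMap.coe_coe, Submodule.starProjection_eq_self_iff.mpr hv]

lemma frameGenerator_of_mem_motionSpan_orthogonal (hRE : IsPlanarRE m q) {v : E4}
    (hv : v ∈ (motionSpan m q)ᗮ) : frameGenerator m q v = 0 := by
  rw [frameGenerator, if_pos hRE, LinearMap.smul_apply, LinearMap.comp_apply,
    ContinuousLinearMap.coe_coe, (Submodule.starProjection_apply_eq_zero_iff _).mpr hv, map_zero,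
    smul_zero]

lemma frameK_of_forall_mem_motionSpan_orthogonal (hRE : IsPlanarRE m q) {x : Config n}
    (hx : ∀ i, x i ∈ (motionSpan m q)ᗮ) : frameK m q x = 0 :=
  PiLp.ext fun i => frameGenerator_of_mem_motionSpan_orthogonal hRE (hx i)

/-- Where `K` is `κ𝐢`, the centrifugal form `⟨MKx, Kx⟩` is `κ² ⟨Mx, x⟩ = U(q) ⟨Mx, x⟩`. -/
lemma effForm_eq_neg_hessForm (hm : ∀ i, 0 < m i) (hq : IsCentralConfiguration m q) {x : Config n}
    (hx : ∀ i, frameGenerator m q (x i) = angularSpeed m q • act quatI (x i)) :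
    effForm m q x = -hessForm m q x := by
  have hrot : ∀ v, ⟪act quatI v, act quatI v⟫_ℝ = ⟪v, v⟫_ℝ := fun v => by
    rw [quatI_skew, act_quatI_quatI, inner_neg_right, neg_neg]
  have hK : massInner m (frameK m q x) (frameK m q x) = potential m q * massInner m x x := by
    have hKi : ∀ i, frameK m q x i = angularSpeed m q • act quatI (x i) := hx
    simp only [massInner_apply, hKi, real_inner_smul_left, real_inner_smul_right, hrot,
      ← angularSpeed_sq hm hq, Finset.mul_sum]
    exact Finset.sum_congr rfl fun i _ => by ring
  rw [effForm_apply, hessForm_apply, hK]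

lemma effForm_restrict_of_not_isPlanarRE (hm : ∀ i, 0 < m i)
    (hq : IsCentralConfiguration m q) (hRE : ¬ IsPlanarRE m q) :
    (effForm m q).restrict (reduced m q) = -(hessForm m q).restrict (reduced m q) := by
  ext x
  exact effForm_eq_neg_hessForm hm hq fun _ => frameGenerator_of_not_isPlanarRE hRE _

lemma effForm_restrict_reducedIn_motionSpan (hm : ∀ i, 0 < m i)
    (hq : IsCentralConfiguration m q) (hRE : IsPlanarRE m q) :
    (effForm m q).restrict (reducedIn m q (motionSpan m q)) =
      -(hessForm m q).restrict (reducedIn m q (motionSpan m q)) := by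
  ext x
  exact effForm_eq_neg_hessForm hm hq fun i =>
    frameGenerator_of_mem_motionSpan hRE ((mem_reducedIn.mp x.2).2 i)

lemma effForm_restrict_equivalent_prod (hq : IsCentralConfiguration m q)
    (hRE : IsPlanarRE m q) :
    (((effForm m q).restrict (reducedIn m q (motionSpan m q))).prod
      ((effForm m q).restrict (reducedIn m q (motionSpan m q)ᗮ))).Equivalent
      ((effForm m q).restrict (reduced m q)) := by
  have hsup := reducedIn_inf_sup_reducedIn_inf_orthogonal (V := ⊤) hRE (mem_motionSpan m q)
    fun _ _ => Submodule.mem_top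
  rw [top_inf_eq, top_inf_eq, reducedIn_top] at hsup
  rw [← hsup]
  refine equivalent_restrict_sup (disjoint_reducedIn (motionSpan m q).orthogonal_disjoint)
    fun x hx y hy => ?_
  have hy' := (mem_reducedIn.mp hy).2
  rw [QuadraticMap.polar_comm, polar_effForm hq,
    inner_hessU_eq_zero hq (mem_motionSpan m q) hy' (mem_reducedIn.mp hx).2,
    frameK_of_forall_mem_motionSpan_orthogonal hRE hy']
  simp

lemma forall_eq_of_sum_norm_sub_sq_le_zero (hm : ∀ i, 0 < m i)
    (hq : IsCentralConfiguration m q) {x : Config n}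
    (hx : ∑ i, ∑ j ∈ Finset.Ioi i, m i * m j * (⟪x i - x j, x i - x j⟫_ℝ / ‖q i - q j‖ ^ 3) ≤ 0)
    (i j : Fin n) : x i = x j := by
  wlog hij : i < j generalizing i j
  · rcases (not_lt.mp hij).eq_or_lt with rfl | h
    exacts [rfl, (this j i h).symm]
  have hterm : ∀ i j, 0 ≤ m i * m j * (⟪x i - x j, x i - x j⟫_ℝ / ‖q i - q j‖ ^ 3) := fun i j =>
    mul_nonneg (mul_pos (hm i) (hm j)).le (div_nonneg real_inner_self_nonneg (by positivity))
  by_contra hne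
  refine hx.not_gt (Finset.sum_pos' (fun i _ => Finset.sum_nonneg fun j _ => hterm i j)
    ⟨i, Finset.mem_univ i, Finset.sum_pos' (fun j _ => hterm i j)
      ⟨j, Finset.mem_Ioi.mpr hij, ?_⟩⟩)
  exact mul_pos (mul_pos (hm i) (hm j)) (div_pos (real_inner_self_pos.mpr (sub_ne_zero.mpr hne))
    (pow_pos (norm_sub_pos_iff.mpr (hq.collisionFree i j hij.ne)) 3))

lemma posDef_effForm_restrict_reducedIn_orthogonal (hm : ∀ i, 0 < m i)
    (hq : IsCentralConfiguration m q) (hRE : IsPlanarRE m q) :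
    ((effForm m q).restrict (reducedIn m q (motionSpan m q)ᗮ)).PosDef := by
  rintro ⟨x, hx⟩ hx0
  obtain ⟨hxr, hxW⟩ := mem_reducedIn.mp hx
  change 0 < effForm m q x
  rw [effForm_apply, frameK_of_forall_mem_motionSpan_orthogonal hRE hxW,
    inner_hessU_of_mem_orthogonal hq (mem_motionSpan m q) hxW, map_zero, add_zero, neg_neg]
  by_contra! hle
  have heq := forall_eq_of_sum_norm_sub_sq_le_zero hm hq hle
  have hxt : x ∈ translations n := by
    have : x = WithLp.toLp 2 fun _ => x ⟨0, zero_lt_one.trans (hq.one_lt hm)⟩ :=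
      PiLp.ext fun i => heq i _
    rw [this]
    exact mem_translations _
  exact hx0 (Subtype.ext
    (eq_zero_of_massInner_self hm (hxr x (Submodule.mem_sup_left hxt))))

end EffectivePotential

section MotionPlane

variable {n : ℕ} {m : Fin n → ℝ} {q : Config n}

lemma finrank_motionSpan (hm : ∀ i, 0 < m i) (hq : IsCentralConfiguration m q)
    (hRE : IsPlanarRE m q) : Module.finrank ℝ (motionSpan m q) = 2 := by
  obtain ⟨i, hi⟩ : ∃ i, q i ≠ 0 := by
    by_contra! h
    exact hq.ne_zero (PiLp.ext h)
  refine le_antisymm hRE ?_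
  have hli : LinearIndependent ℝ ![q i, act quatI (q i)] := by
    refine linearIndependent_of_ne_zero_of_inner_eq_zero (𝕜 := ℝ) (fun k => ?_) fun k l hkl => ?_
    · fin_cases k
      exacts [hi, fun h => hi (act_injective_of_sq_eq_neg_one quatI_mul_quatI (by simpa using h))]
    · have h := quatI_skew.inner_self (q i)
      fin_cases k <;> fin_cases l <;> simp_all [real_inner_comm]
  have hspan : Submodule.span ℝ (Set.range ![q i, act quatI (q i)]) ≤ motionSpan m q := by
    rw [Submodule.span_le]
    rintro _ ⟨k, rfl⟩
    fin_cases k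
    exacts [mem_motionSpan m q i,
      quatI_mem_motionSpan m q (angularSpeed_ne_zero hm hq) (mem_motionSpan m q i)]
  simpa [finrank_span_eq_card hli] using Submodule.finrank_mono hspan

lemma reflection_isSymmetric {E : Type*} [NormedAddCommGroup E] [InnerProductSpace ℝ E]
    (W : Submodule ℝ E) [W.HasOrthogonalProjection] :
    (W.reflection.toLinearIsometry.toLinearMap).IsSymmetric := fun x y => by
  change ⟪W.reflection x, y⟫_ℝ = ⟪x, W.reflection y⟫_ℝ
  rw [← W.reflection.inner_map_map x, W.reflection_reflection]

lemma exists_orthogonal_span_sup_span_eq {E : Type*} [NormedAddCommGroup E]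
    [InnerProductSpace ℝ E] {W : Submodule ℝ E} (hW : Module.finrank ℝ W = 2) :
    ∃ f g : E, ‖f‖ = ‖g‖ ∧ ⟪f, g⟫_ℝ = 0 ∧ (ℝ ∙ g) ⊔ (ℝ ∙ f) = W := by
  have : FiniteDimensional ℝ W := Module.finite_of_finrank_eq_succ hW
  let b := (stdOrthonormalBasis ℝ W).reindex (finCongr hW)
  have hspan : Submodule.span ℝ (Set.range fun k => (b k : E)) = W := by
    rw [← Set.image_univ, ← Set.image_image (Subtype.val : W → E), Set.image_univ]
    change Submodule.span ℝ (W.subtype '' _) = W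
    rw [← Submodule.map_span, ← b.coe_toBasis, b.toBasis.span_eq, Submodule.map_subtype_top]
  refine ⟨b 0, b 1, ?_, b.inner_eq_zero zero_ne_one, ?_⟩
  · exact (b.norm_eq_one 0).trans (b.norm_eq_one 1).symm
  · rw [sup_comm, ← Submodule.span_insert]
    convert hspan
    ext v
    simp [Fin.exists_fin_two, eq_comm]

lemma involutive_blockDiag_reflection (n : ℕ) (U : Submodule ℝ E4) :
    Function.Involutive (blockDiag n U.reflection.toLinearIsometry.toLinearMap) :=
  fun x => PiLp.ext fun i => U.reflection_reflection (x i)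

lemma map_blockDiag_reflection_reducedIn (hRE : IsPlanarRE m q) {U : Submodule ℝ E4}
    (hqU : ∀ i, q i ∈ U) (V : Submodule ℝ E4) :
    (reducedIn m q V).map (blockDiag n U.reflection.toLinearIsometry.toLinearMap) =
      reducedIn m q (V.map U.reflection.toLinearIsometry.toLinearMap) := by
  have hmem {x : Config n} (hx : x ∈ reduced m q) :=
    blockDiag_mem_reduced hRE (reflection_isSymmetric U)
      (fun i => U.reflection_mem_subspace_eq_self (hqU i)) hx
  refine le_antisymm ?_ fun x hx => ?_
  · rintro _ ⟨x, hx, rfl⟩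
    obtain ⟨hxr, hxV⟩ := mem_reducedIn.mp hx
    exact mem_reducedIn.mpr ⟨hmem hxr, fun i => Submodule.mem_map_of_mem (hxV i)⟩
  · obtain ⟨hxr, hxV⟩ := mem_reducedIn.mp hx
    refine ⟨_, mem_reducedIn.mpr ⟨hmem hxr, fun i => ?_⟩,
      involutive_blockDiag_reflection n U x⟩
    obtain ⟨v, hv, hvx⟩ := hxV i
    change U.reflection (x i) ∈ V
    rw [← hvx]
    simpa using hv

lemma hessForm_restrict_equivalent_map_reflection (hq : IsCentralConfiguration m q)
    (hRE : IsPlanarRE m q) {U : Submodule ℝ E4} (hqU : ∀ i, q i ∈ U) (V : Submodule ℝ E4) :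
    ((hessForm m q).restrict (reducedIn m q V)).Equivalent
      ((hessForm m q).restrict
        (reducedIn m q (V.map U.reflection.toLinearIsometry.toLinearMap))) := by
  rw [← map_blockDiag_reflection_reducedIn hRE hqU]
  exact equivalent_restrict_map (involutive_blockDiag_reflection n U).injective _
    fun x _ => hessForm_blockDiag_of_linearIsometry hq U.reflection.toLinearIsometry
      (fun i => U.reflection_mem_subspace_eq_self (hqU i)) x

end MotionPlane

section IndexParity

variable {n : ℕ} {m : Fin n → ℝ} {q : Config n}

lemma hessForm_restrict_equivalent_of_norm_eq (hq : IsCentralConfiguration m q)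
    (hRE : IsPlanarRE m q) {f g : E4} (hfg : ‖f‖ = ‖g‖) (hqf : ∀ i, ⟪f, q i⟫_ℝ = 0)
    (hqg : ∀ i, ⟪g, q i⟫_ℝ = 0) :
    ((hessForm m q).restrict (reducedIn m q (ℝ ∙ f))).Equivalent
      ((hessForm m q).restrict (reducedIn m q (ℝ ∙ g))) := by
  have hqU : ∀ i, q i ∈ (ℝ ∙ (f - g))ᗮ := fun i => by
    rw [Submodule.mem_orthogonal_singleton_iff_inner_right, inner_sub_left, hqf, hqg, sub_zero]
  have h := hessForm_restrict_equivalent_map_reflection hq hRE hqU (ℝ ∙ f)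
  have hswap : (ℝ ∙ (f - g))ᗮ.reflection.toLinearIsometry.toLinearMap f = g :=
    Submodule.reflection_sub hfg
  rwa [Submodule.map_span, Set.image_singleton, hswap] at h

lemma hessForm_restrict_span_sup_span_equivalent_prod (hq : IsCentralConfiguration m q)
    (hRE : IsPlanarRE m q) {f g : E4} (hfg : ⟪f, g⟫_ℝ = 0) (hqf : ∀ i, ⟪f, q i⟫_ℝ = 0) :
    (((hessForm m q).restrict (reducedIn m q (ℝ ∙ g))).prod
      ((hessForm m q).restrict (reducedIn m q (ℝ ∙ f)))).Equivalent
      ((hessForm m q).restrict (reducedIn m q ((ℝ ∙ g) ⊔ (ℝ ∙ f)))) := by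
  have hg : (ℝ ∙ g) ≤ (ℝ ∙ f)ᗮ := by
    rwa [Submodule.span_singleton_le_iff_mem,
      Submodule.mem_orthogonal_singleton_iff_inner_right]
  have h := hessForm_restrict_equivalent_prod (W := (ℝ ∙ f)ᗮ) (V := (ℝ ∙ g) ⊔ (ℝ ∙ f)) hq hRE
    (fun i => Submodule.mem_orthogonal_singleton_iff_inner_right.mpr (hqf i)) fun v hv => by
      rw [Submodule.starProjection_orthogonal_val]
      exact sub_mem hv (Submodule.mem_sup_right (Submodule.starProjection_apply_mem _ v))
  rwa [sup_inf_assoc_of_le _ hg, Submodule.inf_orthogonal_eq_bot, sup_bot_eq,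
    Submodule.orthogonal_orthogonal, inf_eq_right.mpr le_sup_right] at h

/-- The reflection exchanging two orthonormal vectors normal to the plane of motion fixes every body
of `q`, so both contribute equally. -/
lemma even_index_and_nullity_hessForm_restrict_reducedIn_orthogonal (hm : ∀ i, 0 < m i)
    (hq : IsCentralConfiguration m q) (hRE : IsPlanarRE m q) :
    Even (sigPos ((hessForm m q).restrict (reducedIn m q (motionSpan m q)ᗮ))) ∧
      Even (Module.finrank ℝ
        ((hessForm m q).restrict (reducedIn m q (motionSpan m q)ᗮ)).radical) := by
  have hdim : Module.finrank ℝ (motionSpan m q)ᗮ = 2 := by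
    have h := (motionSpan m q).finrank_add_finrank_orthogonal
    rw [finrank_motionSpan hm hq hRE, finrank_euclideanSpace_fin] at h
    omega
  obtain ⟨f, g, hnorm, hfg, hspan⟩ := exists_orthogonal_span_sup_span_eq hdim
  have hqW {w : E4} (hw : w ∈ (ℝ ∙ g) ⊔ (ℝ ∙ f)) (i : Fin n) : ⟪w, q i⟫_ℝ = 0 :=
    Submodule.inner_left_of_mem_orthogonal (mem_motionSpan m q i) (hspan ▸ hw)
  have hqf := hqW (Submodule.mem_sup_right (Submodule.mem_span_singleton_self f))
  have hqg := hqW (Submodule.mem_sup_left (Submodule.mem_span_singleton_self g))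
  have hprod := hessForm_restrict_span_sup_span_equivalent_prod hq hRE hfg hqf
  have hswap := hessForm_restrict_equivalent_of_norm_eq hq hRE hnorm hqf hqg
  rw [← hspan, ← hprod.sigPos_eq, ← hprod.rank_radical_eq, sigPos_prod, finrank_radical_prod,
    hswap.sigPos_eq, hswap.rank_radical_eq]
  exact ⟨Even.add_self _, Even.add_self _⟩

lemma even_index_and_nullity_effForm_iff_of_isPlanarRE (hm : ∀ i, 0 < m i)
    (hq : IsCentralConfiguration m q) (hRE : IsPlanarRE m q) :
    (Even (sigNeg ((effForm m q).restrict (reduced m q))) ↔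
      Even (sigPos ((hessForm m q).restrict (reduced m q)))) ∧
    (Even (Module.finrank ℝ ((effForm m q).restrict (reduced m q)).radical) ↔
      Even (Module.finrank ℝ ((hessForm m q).restrict (reduced m q)).radical)) := by
  have heff := effForm_restrict_equivalent_prod hq hRE
  have hhess := hessForm_restrict_equivalent_prod (V := ⊤) hq hRE (mem_motionSpan m q)
    fun _ _ => Submodule.mem_top
  rw [top_inf_eq, top_inf_eq, reducedIn_top] at hhess
  have hpos := posDef_effForm_restrict_reducedIn_orthogonal hm hq hRE
  have heven := even_index_and_nullity_hessForm_restrict_reducedIn_orthogonal hm hq hRE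
  rw [← heff.sigNeg_eq, ← hhess.sigPos_eq, ← heff.rank_radical_eq, ← hhess.rank_radical_eq,
    sigNeg_prod, sigPos_prod, finrank_radical_prod, finrank_radical_prod,
    sigNeg_eq_zero_of_posDef hpos, finrank_radical_eq_zero_of_posDef hpos,
    effForm_restrict_reducedIn_motionSpan hm hq hRE, sigNeg_neg, radical_neg]
  simp [Nat.even_add, heven]

lemma even_index_and_nullity_effForm_iff (hm : ∀ i, 0 < m i) (hq : IsCentralConfiguration m q) :
    (Even (sigNeg ((effForm m q).restrict (reduced m q))) ↔
      Even (sigPos ((hessForm m q).restrict (reduced m q)))) ∧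
    (Even (Module.finrank ℝ ((effForm m q).restrict (reduced m q)).radical) ↔
      Even (Module.finrank ℝ ((hessForm m q).restrict (reduced m q)).radical)) := by
  by_cases hRE : IsPlanarRE m q
  · exact even_index_and_nullity_effForm_iff_of_isPlanarRE hm hq hRE
  · rw [effForm_restrict_of_not_isPlanarRE hm hq hRE, sigNeg_neg, radical_neg]
    exact ⟨Iff.rfl, Iff.rfl⟩

lemma even_blockSize (m : Fin n → ℝ) (q : Config n) : Even (blockSize m q) := by
  unfold blockSize
  split_ifs <;> decide

lemma even_nullity_formB₃_iff (hm : ∀ i, 0 < m i) (hq : IsCentralConfiguration m q) :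
    Even (Module.finrank ℝ (formB₃ m q).radical) ↔ ¬ Even (nullity m q) := by
  have hnull := nullity_add_one hm hq
  have hb := even_blockSize m q
  rw [finrank_radical_formB₃ hm q, (even_index_and_nullity_effForm_iff hm hq).2]
  simp only [Nat.even_iff] at hb ⊢
  omega

lemma even_sigNeg_formB₃_iff (hm : ∀ i, 0 < m i) (hq : IsCentralConfiguration m q) :
    Even (sigNeg (formB₃ m q)) ↔ ¬ Even (morseIndex m q + nullity m q) := by
  have hnull := nullity_add_one hm hq
  have hdim := finrank_reduced hm hq
  have hsig := QuadraticForm.sigPos_add_sigNeg_add_radical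
    (Q := (hessForm m q).restrict (reduced m q))
  have hb := even_blockSize m q
  rw [sigNeg_formB₃ hm q, (even_index_and_nullity_effForm_iff hm hq).1, morseIndex_eq_sigNeg hm hq]
  simp only [Nat.even_iff] at hb ⊢
  omega

end IndexParity

section Stability

variable {n : ℕ} {m : Fin n → ℝ} {q : Config n}

lemma isAlt_sympForm (n : ℕ) : (sympForm n).IsAlt := fun z => by
  rw [sympForm_apply, real_inner_comm, neg_add_cancel]

/-- The symplectic form of the reduced phase space `E₃`. -/
def sympForm₃ (m : Fin n → ℝ) (q : Config n) : LinearMap.BilinForm ℝ (E₃ m q) :=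
  (sympForm n).restrict (E₃ m q)

lemma isAlt_sympForm₃ (m : Fin n → ℝ) (q : Config n) : (sympForm₃ m q).IsAlt :=
  fun z => isAlt_sympForm n z

lemma nondegenerate_sympForm₃ (hm : ∀ i, 0 < m i) (q : Config n) :
    (sympForm₃ m q).Nondegenerate := by
  refine (isAlt_sympForm₃ m q).isRefl.nondegenerate_iff_separatingLeft.mpr ?_
  rintro ⟨⟨x, p⟩, hz⟩ h
  rw [← massMatrix_massMatrixInv hm p] at hz
  obtain ⟨hx, hy⟩ := mk_massMatrix_mem_E₃.mp hz
  have hx0 : massInner m x x = 0 := by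
    have hω : sympForm n (x, p) (0, massMatrix m x) = 0 :=
      h ⟨_, mk_massMatrix_mem_E₃.mpr ⟨zero_mem _, hx⟩⟩
    rwa [sympForm_apply, inner_zero_right, neg_zero, zero_add, real_inner_comm] at hω
  have hy0 : massInner m (massMatrixInv m p) (massMatrixInv m p) = 0 := by
    have hω : sympForm n (x, p) (massMatrixInv m p, massMatrix m 0) = 0 :=
      h ⟨_, mk_massMatrix_mem_E₃.mpr ⟨hy, zero_mem _⟩⟩
    rw [sympForm_apply, map_zero, inner_zero_right, add_zero, neg_eq_zero] at hω
    change ⟪massMatrix m (massMatrixInv m p), _⟫_ℝ = 0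
    rwa [massMatrix_massMatrixInv hm]
  have hp : p = 0 := by
    rw [← massMatrix_massMatrixInv hm p, eq_zero_of_massInner_self hm hy0, map_zero]
  exact Subtype.ext (Prod.ext (eq_zero_of_massInner_self hm hx0) hp)

lemma isSkewAdjoint_matJB₃ (hm : ∀ i, 0 < m i) (hq : IsCentralConfiguration m q) :
    (sympForm₃ m q).IsSkewAdjoint (matJB₃ hm hq) := fun z w => by
  change sympForm n (matJB m q z) w = sympForm₃ m q z (-matJB₃ hm hq w)
  rw [map_neg, ← neg_eq_iff_eq_neg]
  exact (sympForm_matJB hq z w).symm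

lemma formB₃_eq_hamiltonianForm (hm : ∀ i, 0 < m i) (hq : IsCentralConfiguration m q) :
    formB₃ m q = hamiltonianForm (sympForm₃ m q) (matJB₃ hm hq) := by
  have hJ : ∀ v, stdJ n (stdJ n v) = -v := fun v => by ext1 <;> simp [stdJ]
  ext z
  change phaseInner n (matB m q z) z = -phaseInner n (stdJ n (stdJ n (matB m q z))) z
  rw [hJ, map_neg, LinearMap.neg_apply, neg_neg]

lemma hasNontrivialJordanBlockAtZero_of_even_nullity (hm : ∀ i, 0 < m i)
    (hq : IsCentralConfiguration m q) (hnull : Even (nullity m q)) :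
    HasNontrivialJordanBlockAtZero hm hq := by
  have hω := isAlt_sympForm₃ m q
  have hnd := nondegenerate_sympForm₃ hm q
  have hA := isSkewAdjoint_matJB₃ hm hq
  refine lt_of_le_not_ge (fun z hz => ?_) fun hle => ?_
  · rw [LinearMap.mem_ker] at hz ⊢
    rw [pow_two, Module.End.mul_apply, hz, map_zero]
  · have hker := even_finrank_ker_of_ker_sq_le hω hnd hA hle
    rw [← radical_hamiltonianForm hω hnd hA, ← formB₃_eq_hamiltonianForm,
      even_nullity_formB₃_iff hm hq] at hker
    exact hker hnull

lemma HasNontrivialJordanBlockAtZero.not_linearlyStable {hm : ∀ i, 0 < m i}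
    {hq : IsCentralConfiguration m q} (h : HasNontrivialJordanBlockAtZero hm hq) :
    ¬ LinearlyStable hm hq := fun hs =>
  h.not_ge (ker_sq_le_of_iSup_eigenspace_baseChange_eq_top hs.2)

lemma SpectrallyStable.not_hasEigenvalue {hm : ∀ i, 0 < m i} {hq : IsCentralConfiguration m q}
    (hs : SpectrallyStable hm hq) {c : ℝ} (hc : c ≠ 0) : ¬ (matJB₃ hm hq).HasEigenvalue c :=
  fun h => hc (hs _ (hasEigenvalue_baseChange ℂ h))

lemma not_spectrallyStable (hm : ∀ i, 0 < m i) (hq : IsCentralConfiguration m q)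
    (hker : Even (indexOnGeneralizedKernel hm hq)) (h : Even (morseIndex m q + nullity m q)) :
    ¬ SpectrallyStable hm hq := fun hs => by
  have hparity := even_sigNeg_hamiltonianForm_iff (isAlt_sympForm₃ m q)
    (nondegenerate_sympForm₃ hm q) (isSkewAdjoint_matJB₃ hm hq) fun _ => hs.not_hasEigenvalue
  rw [← formB₃_eq_hamiltonianForm, finrank_E₃ hm hq, even_sigNeg_formB₃_iff hm hq] at hparity
  exact hparity.mpr hker h

lemma even_finrank_orbitTangent_iff (hq : q ≠ 0) :
    Even (Module.finrank ℝ (orbitTangent q)) ↔ ¬ IsPlanar q := by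
  by_cases hp : IsPlanar q
  · have h : ¬ Even (Module.finrank ℝ (orbitTangent q)) := by
      by_cases hc : IsCollinear q
      · rw [finrank_orbitTangent_of_collinear hq hc]
        decide
      · rw [finrank_orbitTangent_of_planar hp hc]
        decide
    exact iff_of_false h (not_not_intro hp)
  · rw [finrank_orbitTangent_of_not_planar hp]
    exact iff_of_true (by decide) hp

lemma IsMorseBottNondegenerate.even_nullity_iff (h : IsMorseBottNondegenerate m q) (hq : q ≠ 0) :
    Even (nullity m q) ↔ ¬ IsPlanar q := by
  rw [h, even_finrank_orbitTangent_iff hq]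

end Stability

end NBody

end

theorem mainTheorem2 (n : ℕ) (hn : 3 ≤ n) (m : Fin n → ℝ) (hm : ∀ i, 0 < m i)
    (q : NBody.Config n) (hq : NBody.IsCentralConfiguration m q) :
    ((¬ NBody.IsPlanar q ∧ NBody.IsMorseBottNondegenerate m q) ∨
        (¬ NBody.IsMorseBottNondegenerate m q ∧ Even (NBody.nullity m q)) →
      NBody.HasNontrivialJordanBlockAtZero hm hq ∧ ¬ NBody.LinearlyStable hm hq) ∧
    (Even (NBody.indexOnGeneralizedKernel hm hq) →
      (Even (NBody.morseIndex m q + NBody.nullity m q) → ¬ NBody.SpectrallyStable hm hq) ∧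
      (NBody.IsMorseBottNondegenerate m q →
        (¬ NBody.IsPlanar q → Even (NBody.morseIndex m q) → ¬ NBody.SpectrallyStable hm hq) ∧
        (NBody.IsPlanar q → Odd (NBody.morseIndex m q) → ¬ NBody.SpectrallyStable hm hq))) := by
  refine ⟨fun h => ?_, fun hker => ⟨NBody.not_spectrallyStable hm hq hker, fun hnd => ?_⟩⟩
  · have hnull : Even (NBody.nullity m q) := by
      rcases h with ⟨hnp, hnd⟩ | ⟨-, hnull⟩
      exacts [(hnd.even_nullity_iff hq.ne_zero).mpr hnp, hnull]
    have hJordan := NBody.hasNontrivialJordanBlockAtZero_of_even_nullity hm hq hnull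
    exact ⟨hJordan, hJordan.not_linearlyStable⟩
  · have hnull := hnd.even_nullity_iff hq.ne_zero
    refine ⟨fun hnp hindex => ?_, fun hp hindex => ?_⟩
    · exact NBody.not_spectrallyStable hm hq hker (hindex.add (hnull.mpr hnp))
    · have hodd : Odd (NBody.nullity m q) :=
        Nat.not_even_iff_odd.mp fun heven => hnull.mp heven hp
      exact NBody.not_spectrallyStable hm hq hker (hindex.add_odd hodd)
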